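/- A non-deterministic timed automaton with silent transitions (eNTA) is a tuple $A=(Q,q_0,\Sigma\cup\{\varepsilon\},C,T)$ with a finite set $Q$ of locations, an initial location $q_0\in Q$, a finite set $\Sigma$ of observable actions, the silent action $\varepsilon\notin\Sigma$, a finite set $C$ of clocks, and a finite set $T$ of transitions $(q,a,g,R,q')$, where $q,q'\in Q$, $a\in\Sigma\cup\{\varepsilon\}$, the guard $g$ is a finite conjunction of constraints $c\sim n$ with $c\in C$, ${\sim}\in\{<,\le,=,\ge,>\}$, $n\in\mathbb{N}_0$, and $R\subseteq C$ is the set of clocks that are reset. A run starts in $q_0$ with all clocks equal to $0$ and alternates delays $d_i\in\mathbb{R}_{\ge 0}$, during which all clocks advance by $d_i$, and transitions $(q_{i-1},a_i,g_i,R_i,q_i)\in T$ whose guard holds at that moment and which then set the clocks in $R_i$ to $0$; it is finite. Its timed trace is $(t_1,a_1),\dots,(t_k,a_k)$ with $t_i=d_1+\dots+d_i$. The timestamp $\mathfrak{TS}(A)\subseteq\mathbb{R}_{\ge 0}\times\Sigma$ is the set of all pairs $(t,a)$ with $a\in\Sigma$ that occur in the timed trace of some run of $A$. The automaton is deterministic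 if it has no silent transitions and every timed trace is induced by a unique run. **Theorem.** There is an algorithm (a computable function on finite presentations) that constructs, from any eNTA $A$, a deterministic timed automaton $TSA(A)$ over the same set $\Sigma$ of observable actions, with a single clock, such that $$\mathfrak{TS}(TSA(A))=\mathfrak{TS}(A),$$ and such that the graph of $TSA(A)$ is a "bouquet of flowers": it is the union, over the actions $a\in\Sigma$, of subgraphs $F_a$, any two of which share the initial location only; all transitions of $F_a$ are labelled by $a$; and $F_a$ consists of a simple path of positive length starting at the initial location (the stalk), possibly followed by a simple loop (the flower) based at the last location of the stalk and otherwise disjoint from the stalk. -/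

import Mathlib

open scoped NNReal

/-- The comparison symbols `<, ≤, =, ≥, >` that may occur in a clock constraint. -/
inductive Cmp where
  | lt | le | eq | ge | gt

/-- The relation on non-negative reals denoted by a comparison symbol. -/
def Cmp.Holds : Cmp → ℝ≥0 → ℝ≥0 → Prop
  | .lt, x, y => x < y
  | .le, x, y => x ≤ y
  | .eq, x, y => x = y
  | .ge, x, y => x ≥ y
  | .gt, x, y => x > y

/-- An atomic clock constraint `clock ∼ bound`, with a natural number as bound. -/
structure ClockConstraint where
  clock : ℕ
  cmp : Cmp
  bound : ℕ

/-- A transition `(src, act, guard, resets, tgt)`. The action `none` is the silent action `ε`,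
and `some a` is the observable action `a`. The guard is the conjunction of the listed constraints,
and `resets` lists the clocks that are reset to zero. -/
structure Transition where
  src : ℕ
  act : Option ℕ
  guard : List ClockConstraint
  resets : List ℕ
  tgt : ℕ

/-- A finite presentation of a timed automaton: its locations are `0, …, numLocs - 1`, its
observable actions are `0, …, numActs - 1`, its clocks are `0, …, numClocks - 1`. -/
structure TimedAutomaton where
  numLocs : ℕ
  init : ℕ
  numActs : ℕ
  numClocks : ℕ
  trans : List Transition

/-! ### The standard encodings, so that computability of maps of automata makes sense -/

def Cmp.equivFin : Cmp ≃ Fin 5 where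
  toFun
    | .lt => 0
    | .le => 1
    | .eq => 2
    | .ge => 3
    | .gt => 4
  invFun
    | 0 => .lt
    | 1 => .le
    | 2 => .eq
    | 3 => .ge
    | 4 => .gt
  left_inv c := by cases c <;> rfl
  right_inv i := by fin_cases i <;> rfl

instance : Primcodable Cmp := Primcodable.ofEquiv (Fin 5) Cmp.equivFin

def ClockConstraint.equivProd : ClockConstraint ≃ ℕ × Cmp × ℕ where
  toFun g := (g.clock, g.cmp, g.bound)
  invFun p := ⟨p.1, p.2.1, p.2.2⟩
  left_inv _ := rfl
  right_inv _ := rfl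

instance : Primcodable ClockConstraint :=
  Primcodable.ofEquiv (ℕ × Cmp × ℕ) ClockConstraint.equivProd

def Transition.equivProd :
    Transition ≃ ℕ × Option ℕ × List ClockConstraint × List ℕ × ℕ where
  toFun τ := (τ.src, τ.act, τ.guard, τ.resets, τ.tgt)
  invFun p := ⟨p.1, p.2.1, p.2.2.1, p.2.2.2.1, p.2.2.2.2⟩
  left_inv _ := rfl
  right_inv _ := rfl

instance : Primcodable Transition :=
  Primcodable.ofEquiv (ℕ × Option ℕ × List ClockConstraint × List ℕ × ℕ) Transition.equivProd

def TimedAutomaton.equivProd : TimedAutomaton ≃ ℕ × ℕ × ℕ × ℕ × List Transition where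
  toFun A := (A.numLocs, A.init, A.numActs, A.numClocks, A.trans)
  invFun p := ⟨p.1, p.2.1, p.2.2.1, p.2.2.2.1, p.2.2.2.2⟩
  left_inv _ := rfl
  right_inv _ := rfl

instance : Primcodable TimedAutomaton :=
  Primcodable.ofEquiv (ℕ × ℕ × ℕ × ℕ × List Transition) TimedAutomaton.equivProd

/-- The presentation is a non-deterministic timed automaton with silent transitions (eNTA):
it mentions only its own locations, actions and clocks. -/
structure TimedAutomaton.IsENTA (A : TimedAutomaton) : Prop where
  init_lt : A.init < A.numLocs
  src_lt : ∀ τ ∈ A.trans, τ.src < A.numLocs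
  tgt_lt : ∀ τ ∈ A.trans, τ.tgt < A.numLocs
  act_lt : ∀ τ ∈ A.trans, ∀ a, τ.act = some a → a < A.numActs
  guard_lt : ∀ τ ∈ A.trans, ∀ g ∈ τ.guard, g.clock < A.numClocks
  resets_lt : ∀ τ ∈ A.trans, ∀ c ∈ τ.resets, c < A.numClocks

/-! ### Semantics -/

/-- A clock valuation (only the values at the clocks of the automaton matter). -/
abbrev ClockValuation := ℕ → ℝ≥0

/-- `v + d`: let `d` time units pass. -/
def ClockValuation.delay (v : ClockValuation) (d : ℝ≥0) : ClockValuation := fun c => v c + d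

/-- `v[R]`: set the clocks in `R` to zero. -/
def ClockValuation.reset (v : ClockValuation) (R : List ℕ) : ClockValuation := fun c => if c ∈ R then 0 else v c

/-- `v ⊨ g` for a guard `g`. -/
def ClockValuation.Satisfies (v : ClockValuation) (g : List ClockConstraint) : Prop :=
  ∀ k ∈ g, k.cmp.Holds (v k.clock) (k.bound : ℝ≥0)

/-- The sequence `(d₁, τ₁), …, (dₖ, τₖ)` of delays and transitions can be executed from the
state `(q, v)`. -/
def TimedAutomaton.IsRunFrom (A : TimedAutomaton) :
    ℕ → ClockValuation → List (ℝ≥0 × Transition) → Prop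
  | _, _, [] => True
  | q, v, (d, τ) :: ρ =>
      τ ∈ A.trans ∧ τ.src = q ∧ (v.delay d).Satisfies τ.guard ∧
        A.IsRunFrom τ.tgt ((v.delay d).reset τ.resets) ρ

/-- A run of `A`: it starts in the initial location with all clocks zero. The intermediate states
are determined by the delays and the transitions. -/
def TimedAutomaton.IsRun (A : TimedAutomaton) (ρ : List (ℝ≥0 × Transition)) : Prop :=
  A.IsRunFrom A.init (fun _ => 0) ρ

/-- The timed trace of a sequence of delays and transitions that begins at absolute time `t`. -/
def timedTraceFrom : ℝ≥0 → List (ℝ≥0 × Transition) → List (ℝ≥0 × Option ℕ)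
  | _, [] => []
  | t, (d, τ) :: ρ => (t + d, τ.act) :: timedTraceFrom (t + d) ρ

/-- The timed trace `(t₁, a₁), …, (tₖ, aₖ)`, where `tᵢ = d₁ + ⋯ + dᵢ`. -/
def timedTrace (ρ : List (ℝ≥0 × Transition)) : List (ℝ≥0 × Option ℕ) := timedTraceFrom 0 ρ

/-- The observable timed trace: the silent pairs are deleted. -/
def observableTrace (ρ : List (ℝ≥0 × Transition)) : List (ℝ≥0 × ℕ) :=
  (timedTrace ρ).filterMap fun p => p.2.map fun a => (p.1, a)

/-- The timestamp of an automaton: all pairs `(t, a)` that occur in the observable timed trace of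
some run. -/
def TimedAutomaton.timestamp (A : TimedAutomaton) : Set (ℝ≥0 × ℕ) :=
  {p | ∃ ρ, A.IsRun ρ ∧ p ∈ observableTrace ρ}

/-- A deterministic timed automaton (DTA): there are no silent transitions, and every timed trace
is induced by a unique run. -/
structure TimedAutomaton.IsDeterministic (A : TimedAutomaton) : Prop where
  no_silent : ∀ τ ∈ A.trans, τ.act ≠ none
  unique_run : ∀ ρ ρ', A.IsRun ρ → A.IsRun ρ' → timedTrace ρ = timedTrace ρ' → ρ = ρ'

/-! ### Bouquets of flowers -/

/-- The list of edges `l` is a path from location `p` to location `q`. -/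
def IsPath : ℕ → List Transition → ℕ → Prop
  | p, [], q => p = q
  | p, τ :: l, q => τ.src = p ∧ IsPath τ.tgt l q

/-- The locations other than the initial one that lie on the flower with the given stalk and loop.
The last edge of a loop returns to the end of the stalk, which is already listed. -/
def flowerLocs (stalk loop : List Transition) : List ℕ :=
  (stalk ++ loop.dropLast).map Transition.tgt

/-- `stalk` followed by `loop` is a flower with label `a`, rooted at `q₀`: a simple path of positive
length from `q₀` to some location `q`, and then either nothing (`loop = []`) or a simple loop at `q`
that otherwise avoids the stalk, all edges being labelled by the action `a`. -/
structure IsFlower (q₀ a : ℕ) (stalk loop : List Transition) : Prop where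
  stalk_ne_nil : stalk ≠ []
  path : ∃ q, IsPath q₀ stalk q ∧ IsPath q loop q
  label : ∀ τ ∈ stalk ++ loop, τ.act = some a
  simple : (q₀ :: flowerLocs stalk loop).Nodup

/-- The graph of `A` is a bouquet of flowers: the union of one flower for each observable action,
any two of them sharing the initial location only. -/
def TimedAutomaton.IsBouquet (A : TimedAutomaton) : Prop :=
  ∃ stalk loop : ℕ → List Transition,
    (∀ a < A.numActs, IsFlower A.init a (stalk a) (loop a)) ∧
    (∀ a < A.numActs, ∀ b < A.numActs, a ≠ b →
      (flowerLocs (stalk a) (loop a)).Disjoint (flowerLocs (stalk b) (loop b))) ∧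
    (∀ τ, τ ∈ A.trans ↔ ∃ a < A.numActs, τ ∈ stalk a ++ loop a) ∧
    (∀ q < A.numLocs, q = A.init ∨ ∃ a < A.numActs, q ∈ flowerLocs (stalk a) (loop a))

/-! ### Primitive recursive functions, set up for `fun_prop` -/

attribute [fun_prop] Primrec

namespace Primrec

attribute [fun_prop] Primrec.const Primrec.comp Primrec.fst Primrec.snd Primrec.pair

variable {α β γ σ : Type*} [Primcodable α] [Primcodable β] [Primcodable γ] [Primcodable σ]

@[fun_prop]
theorem id_fun : Primrec (fun a : α => a) := Primrec.id

@[fun_prop]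
theorem fst_fun {f : α → β × γ} (hf : Primrec f) : Primrec fun a => (f a).1 := fst.comp hf

@[fun_prop]
theorem snd_fun {f : α → β × γ} (hf : Primrec f) : Primrec fun a => (f a).2 := snd.comp hf

@[fun_prop]
theorem add_fun {f g : α → ℕ} (hf : Primrec f) (hg : Primrec g) : Primrec fun a => f a + g a :=
  nat_add.comp hf hg

@[fun_prop]
theorem sub_fun {f g : α → ℕ} (hf : Primrec f) (hg : Primrec g) : Primrec fun a => f a - g a :=
  nat_sub.comp hf hg

@[fun_prop]
theorem mul_fun {f g : α → ℕ} (hf : Primrec f) (hg : Primrec g) : Primrec fun a => f a * g a :=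
  nat_mul.comp hf hg

@[fun_prop]
theorem div_fun {f g : α → ℕ} (hf : Primrec f) (hg : Primrec g) : Primrec fun a => f a / g a :=
  nat_div.comp hf hg

@[fun_prop]
theorem mod_fun {f g : α → ℕ} (hf : Primrec f) (hg : Primrec g) : Primrec fun a => f a % g a :=
  nat_mod.comp hf hg

@[fun_prop]
theorem min_fun {f g : α → ℕ} (hf : Primrec f) (hg : Primrec g) : Primrec fun a => min (f a) (g a) :=
  nat_min.comp hf hg

@[fun_prop]
theorem max_fun {f g : α → ℕ} (hf : Primrec f) (hg : Primrec g) : Primrec fun a => max (f a) (g a) :=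
  nat_max.comp hf hg

@[fun_prop]
theorem pow_fun {f g : α → ℕ} (hf : Primrec f) (hg : Primrec g) : Primrec fun a => f a ^ g a :=
  (Primrec₂.unpaired'.1 Nat.Primrec.pow).comp hf hg

@[fun_prop]
theorem factorial_fun {f : α → ℕ} (hf : Primrec f) : Primrec fun a => (f a).factorial :=
  Primrec.comp (f := Nat.factorial)
    ((nat_rec₁ 1 (f := fun n ih => (n + 1) * ih)
      (nat_mul.comp (succ.comp fst) snd)).of_eq fun n => by
        induction n with
        | zero => rfl
        | succ n ih => simp [Nat.factorial_succ, ih]) hf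

@[fun_prop]
theorem decide_lt_fun {f g : α → ℕ} (hf : Primrec f) (hg : Primrec g) :
    Primrec fun a => decide (f a < g a) :=
  (primrecRel_iff_primrec_decide.1 nat_lt).comp hf hg

@[fun_prop]
theorem decide_le_fun {f g : α → ℕ} (hf : Primrec f) (hg : Primrec g) :
    Primrec fun a => decide (f a ≤ g a) :=
  (primrecRel_iff_primrec_decide.1 nat_le).comp hf hg

@[fun_prop]
theorem beq_fun [BEq β] [LawfulBEq β] {f g : α → β} (hf : Primrec f) (hg : Primrec g) :
    Primrec fun a => f a == g a := by
  classical
  exact ((primrecRel_iff_primrec_decide.1 Primrec.eq).comp hf hg).of_eq fun a => by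
    by_cases h : f a = g a <;> simp [h]

@[fun_prop]
theorem and_fun {f g : α → Bool} (hf : Primrec f) (hg : Primrec g) : Primrec fun a => f a && g a :=
  Primrec.and.comp hf hg

@[fun_prop]
theorem or_fun {f g : α → Bool} (hf : Primrec f) (hg : Primrec g) : Primrec fun a => f a || g a :=
  Primrec.or.comp hf hg

@[fun_prop]
theorem cond_fun {c : α → Bool} {f g : α → σ} (hc : Primrec c) (hf : Primrec f) (hg : Primrec g) :
    Primrec fun a => bif c a then f a else g a :=
  Primrec.cond hc hf hg

@[fun_prop]
theorem option_some_fun {f : α → β} (hf : Primrec f) : Primrec fun a => some (f a) :=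
  option_some.comp hf

@[fun_prop]
theorem option_getD_fun {f : α → Option β} {g : α → β} (hf : Primrec f) (hg : Primrec g) :
    Primrec fun a => (f a).getD (g a) :=
  option_getD.comp hf hg

@[fun_prop]
theorem option_map_fun {f : α → Option β} {g : α → β → γ} (hf : Primrec f)
    (hg : Primrec fun p : α × β => g p.1 p.2) : Primrec fun a => (f a).map (g a) :=
  option_map hf hg

@[fun_prop]
theorem list_cons_fun {f : α → β} {g : α → List β} (hf : Primrec f) (hg : Primrec g) :
    Primrec fun a => f a :: g a :=
  list_cons.comp hf hg

@[fun_prop]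
theorem list_length_fun {f : α → List β} (hf : Primrec f) : Primrec fun a => (f a).length :=
  list_length.comp hf

@[fun_prop]
theorem list_head?_fun {f : α → List β} (hf : Primrec f) : Primrec fun a => (f a).head? :=
  list_head?.comp hf

@[fun_prop]
theorem list_range_fun {f : α → ℕ} (hf : Primrec f) : Primrec fun a => List.range (f a) :=
  list_range.comp hf

@[fun_prop]
theorem list_getD_fun {f : α → List β} {g : α → ℕ} {d : α → β} (hf : Primrec f) (hg : Primrec g)
    (hd : Primrec d) : Primrec fun a => (f a).getD (g a) (d a) := by
  simp only [List.getD_eq_getElem?_getD]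
  exact option_getD.comp (list_getElem?.comp hf hg) hd

@[fun_prop]
theorem list_map_fun {f : α → List β} {g : α → β → γ} (hf : Primrec f)
    (hg : Primrec fun p : α × β => g p.1 p.2) : Primrec fun a => (f a).map (g a) :=
  list_map hf hg

@[fun_prop]
theorem list_flatMap_fun {f : α → List β} {g : α → β → List γ} (hf : Primrec f)
    (hg : Primrec fun p : α × β => g p.1 p.2) : Primrec fun a => (f a).flatMap (g a) :=
  list_flatMap hf hg

@[fun_prop]
theorem list_foldr_fun {f : α → List β} {g : α → σ} {h : α → β → σ → σ} (hf : Primrec f)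
    (hg : Primrec g) (hh : Primrec fun p : α × β × σ => h p.1 p.2.1 p.2.2) :
    Primrec fun a => (f a).foldr (h a) (g a) :=
  list_foldr (h := fun a p => h a p.1 p.2) hf hg hh

@[fun_prop]
theorem list_any_fun {f : α → List β} {g : α → β → Bool} (hf : Primrec f)
    (hg : Primrec fun p : α × β => g p.1 p.2) : Primrec fun a => (f a).any (g a) :=
  (list_foldr hf (const false) (h := fun a p => g a p.1 || p.2)
    (Primrec.or.comp (hg.comp (pair fst (fst.comp snd))) (snd.comp snd))).of_eq
    fun a => by induction f a <;> simp [*]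

@[fun_prop]
theorem list_all_fun {f : α → List β} {g : α → β → Bool} (hf : Primrec f)
    (hg : Primrec fun p : α × β => g p.1 p.2) : Primrec fun a => (f a).all (g a) :=
  (list_foldr hf (const true) (h := fun a p => g a p.1 && p.2)
    (Primrec.and.comp (hg.comp (pair fst (fst.comp snd))) (snd.comp snd))).of_eq
    fun a => by induction f a <;> simp [*]

@[fun_prop]
theorem list_filter_fun {f : α → List β} {g : α → β → Bool} (hf : Primrec f)
    (hg : Primrec fun p : α × β => g p.1 p.2) : Primrec fun a => (f a).filter (g a) :=
  (list_flatMap_fun (g := fun a b => bif g a b then [b] else []) hf (by fun_prop)).of_eq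
    fun a => by induction f a with
      | nil => rfl
      | cons b l ih => cases h : g a b <;> simp [ih, h]

@[fun_prop]
theorem nat_iterate_fun {n : α → ℕ} {f : α → β → β} {g : α → β} (hn : Primrec n)
    (hf : Primrec fun p : α × β => f p.1 p.2) (hg : Primrec g) :
    Primrec fun a => (f a)^[n a] (g a) :=
  nat_iterate hn hg hf

end Primrec

/-! #### The projections and constructors of presentations of automata -/

section Presentations

variable {α : Type*} [Primcodable α]

@[fun_prop]
theorem primrec_clockConstraint_clock {f : α → ClockConstraint} (hf : Primrec f) :
    Primrec fun a => (f a).clock :=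
  Primrec.fst.comp ((Primrec.of_equiv (e := ClockConstraint.equivProd)).comp hf)

@[fun_prop]
theorem primrec_clockConstraint_cmp {f : α → ClockConstraint} (hf : Primrec f) :
    Primrec fun a => (f a).cmp :=
  (Primrec.fst.comp Primrec.snd).comp
    ((Primrec.of_equiv (e := ClockConstraint.equivProd)).comp hf)

@[fun_prop]
theorem primrec_clockConstraint_bound {f : α → ClockConstraint} (hf : Primrec f) :
    Primrec fun a => (f a).bound :=
  (Primrec.snd.comp Primrec.snd).comp
    ((Primrec.of_equiv (e := ClockConstraint.equivProd)).comp hf)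

@[fun_prop]
theorem primrec_clockConstraint_mk {f : α → ℕ} {g : α → Cmp} {h : α → ℕ} (hf : Primrec f)
    (hg : Primrec g) (hh : Primrec h) : Primrec fun a => (⟨f a, g a, h a⟩ : ClockConstraint) :=
  (Primrec.of_equiv_symm (e := ClockConstraint.equivProd)).comp (hf.pair (hg.pair hh))

theorem primrec_transition_equivProd {f : α → Transition} (hf : Primrec f) :
    Primrec fun a => Transition.equivProd (f a) :=
  Primrec.of_equiv.comp hf

@[fun_prop]
theorem primrec_transition_src {f : α → Transition} (hf : Primrec f) :
    Primrec fun a => (f a).src :=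
  Primrec.fst.comp (primrec_transition_equivProd hf)

@[fun_prop]
theorem primrec_transition_act {f : α → Transition} (hf : Primrec f) :
    Primrec fun a => (f a).act :=
  (Primrec.fst.comp Primrec.snd).comp (primrec_transition_equivProd hf)

@[fun_prop]
theorem primrec_transition_guard {f : α → Transition} (hf : Primrec f) :
    Primrec fun a => (f a).guard :=
  (Primrec.fst.comp (Primrec.snd.comp Primrec.snd)).comp (primrec_transition_equivProd hf)

@[fun_prop]
theorem primrec_transition_resets {f : α → Transition} (hf : Primrec f) :
    Primrec fun a => (f a).resets :=
  (Primrec.fst.comp (Primrec.snd.comp (Primrec.snd.comp Primrec.snd))).comp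
    (primrec_transition_equivProd hf)

@[fun_prop]
theorem primrec_transition_tgt {f : α → Transition} (hf : Primrec f) :
    Primrec fun a => (f a).tgt :=
  (Primrec.snd.comp (Primrec.snd.comp (Primrec.snd.comp Primrec.snd))).comp
    (primrec_transition_equivProd hf)

@[fun_prop]
theorem primrec_transition_mk {s : α → ℕ} {a : α → Option ℕ} {g : α → List ClockConstraint}
    {r : α → List ℕ} {t : α → ℕ} (hs : Primrec s) (ha : Primrec a) (hg : Primrec g)
    (hr : Primrec r) (ht : Primrec t) :
    Primrec fun x => (⟨s x, a x, g x, r x, t x⟩ : Transition) :=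
  (Primrec.of_equiv_symm (e := Transition.equivProd)).comp
    (hs.pair (ha.pair (hg.pair (hr.pair ht))))

theorem primrec_timedAutomaton_equivProd {f : α → TimedAutomaton} (hf : Primrec f) :
    Primrec fun a => TimedAutomaton.equivProd (f a) :=
  Primrec.of_equiv.comp hf

@[fun_prop]
theorem primrec_timedAutomaton_numLocs {f : α → TimedAutomaton} (hf : Primrec f) :
    Primrec fun a => (f a).numLocs :=
  Primrec.fst.comp (primrec_timedAutomaton_equivProd hf)

@[fun_prop]
theorem primrec_timedAutomaton_init {f : α → TimedAutomaton} (hf : Primrec f) :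
    Primrec fun a => (f a).init :=
  (Primrec.fst.comp Primrec.snd).comp (primrec_timedAutomaton_equivProd hf)

@[fun_prop]
theorem primrec_timedAutomaton_numActs {f : α → TimedAutomaton} (hf : Primrec f) :
    Primrec fun a => (f a).numActs :=
  (Primrec.fst.comp (Primrec.snd.comp Primrec.snd)).comp (primrec_timedAutomaton_equivProd hf)

@[fun_prop]
theorem primrec_timedAutomaton_numClocks {f : α → TimedAutomaton} (hf : Primrec f) :
    Primrec fun a => (f a).numClocks :=
  (Primrec.fst.comp (Primrec.snd.comp (Primrec.snd.comp Primrec.snd))).comp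
    (primrec_timedAutomaton_equivProd hf)

@[fun_prop]
theorem primrec_timedAutomaton_trans {f : α → TimedAutomaton} (hf : Primrec f) :
    Primrec fun a => (f a).trans :=
  (Primrec.snd.comp (Primrec.snd.comp (Primrec.snd.comp Primrec.snd))).comp
    (primrec_timedAutomaton_equivProd hf)

@[fun_prop]
theorem primrec_timedAutomaton_mk {l i a c : α → ℕ} {t : α → List Transition} (hl : Primrec l)
    (hi : Primrec i) (ha : Primrec a) (hc : Primrec c) (ht : Primrec t) :
    Primrec fun x => (⟨l x, i x, a x, c x, t x⟩ : TimedAutomaton) :=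
  (Primrec.of_equiv_symm (e := TimedAutomaton.equivProd)).comp
    (hl.pair (hi.pair (ha.pair (hc.pair ht))))

end Presentations

/-! ### The discrete abstraction of an automaton -/

/-- Two families have the same order pattern on the indices below `N`. -/
def SameOrder {α β : Type*} [LT α] [LT β] (N : ℕ) (f : ℕ → α) (g : ℕ → β) : Prop :=
  ∀ i < N, ∀ j < N, f i < f j ↔ g i < g j

/-- The list `l` as a sequence, continued by zeros. -/
def entry (l : List ℕ) (i : ℕ) : ℕ := l.getD i 0

/-- All words of a given length over the alphabet `{0, …, b - 1}`. -/
def words (b n : ℕ) : List (List ℕ) :=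
  (fun L => L.flatMap fun l => (List.range b).map fun x => x :: l)^[n] [[]]

/-- The decision procedure for `SameOrder` on sequences given by lists. -/
def sameOrder (N : ℕ) (x y : List ℕ) : Bool :=
  (List.range N).all fun i => (List.range N).all fun j =>
    decide (entry x i < entry x j) == decide (entry y i < entry y j)

/-- The truth value of `x ∼ y` in terms of those of `x < y` and `x = y`. -/
def Cmp.eval : Cmp → Bool → Bool → Bool
  | .lt, l, _ => l
  | .le, l, e => l || e
  | .eq, _, e => e
  | .ge, l, _ => !l
  | .gt, l, e => !(l || e)

/-- An abstract state: a location, a list with the order pattern of `0`, of the fractional part of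
the current time and of the fractional parts of the times of the last resets, and a list with the
numbers of integer ticks between the last resets and the current time, truncated. -/
abbrev AbstractState := ℕ × List ℕ × List ℕ

namespace TimedAutomaton

/-- A bound for the constants in the guards. -/
def maxConst (A : TimedAutomaton) : ℕ :=
  (A.trans.flatMap fun τ => τ.guard.map fun g => g.bound).foldr (fun b m => max b m) 0

/-- The number of fractional parts that are compared in an abstract state. -/
def numItems (A : TimedAutomaton) : ℕ := A.numClocks + 2

/-- The abstract states of `A`. -/
def abstractStates (A : TimedAutomaton) : List AbstractState :=
  (List.range A.numLocs).flatMap fun q => (words A.numItems A.numItems).flatMap fun x =>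
    (words (A.maxConst + 2) A.numClocks).map fun k => (q, x, k)

/-- Time passes without reaching the next integer. -/
def slides (A : TimedAutomaton) (c c' : AbstractState) : Bool :=
  c.1 == c'.1 && (((words (A.numItems + 1) (A.numItems + 1)).any fun l =>
      decide (entry l 1 < entry l A.numItems) && (sameOrder A.numItems l c.2.1 &&
        sameOrder A.numItems
          ((List.range A.numItems).map fun i => bif i == 1 then entry l A.numItems else entry l i)
          c'.2.1)) &&
    (List.range A.numClocks).all fun i => entry c'.2.2 i == entry c.2.2 i)

/-- Time passes until the next integer. -/
def ticks (A : TimedAutomaton) (c c' : AbstractState) : Bool :=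
  c.1 == c'.1 && (sameOrder A.numItems
      ((List.range A.numItems).map fun i => bif i == 1 then entry c.2.1 0 else entry c.2.1 i)
      c'.2.1 &&
    (List.range A.numClocks).all fun i =>
      entry c'.2.2 i == min (entry c.2.2 i + 1) (A.maxConst + 1))

end TimedAutomaton

/-- The transition `τ` is enabled in the abstract state `c`. -/
def AbstractState.enables (c : AbstractState) (τ : Transition) : Bool :=
  τ.src == c.1 && τ.guard.all fun g =>
    g.cmp.eval
      (decide (entry c.2.2 g.clock < g.bound) ||
        (entry c.2.2 g.clock == g.bound && decide (entry c.2.1 1 < entry c.2.1 (g.clock + 2))))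
      (entry c.2.2 g.clock == g.bound && entry c.2.1 1 == entry c.2.1 (g.clock + 2))

namespace TimedAutomaton

/-- The transition `τ` leads from `c` to `c'`, provided that it is enabled. -/
def fires (A : TimedAutomaton) (τ : Transition) (c c' : AbstractState) : Bool :=
  τ.tgt == c'.1 && (sameOrder A.numItems
      ((List.range A.numItems).map fun i =>
        bif τ.resets.any fun r => r + 2 == i then entry c.2.1 1 else entry c.2.1 i)
      c'.2.1 &&
    (List.range A.numClocks).all fun i =>
      entry c'.2.2 i == bif τ.resets.any fun r => r == i then 0 else entry c.2.2 i)

/-- A step of the abstract system that does not reach the next integer time. -/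
def smallStep (A : TimedAutomaton) (c c' : AbstractState) : Bool :=
  A.slides c c' || A.trans.any fun τ => c.enables τ && A.fires τ c c'

/-- Add to `Y` the abstract states that can be reached by one small step. -/
def grow (A : TimedAutomaton) (Y : List AbstractState) : List AbstractState :=
  A.abstractStates.filter fun c' => Y.any (fun c => c == c') || Y.any fun c => A.smallStep c c'

/-- Add to `Y` the abstract states that can be reached by small steps. -/
def smallClosure (A : TimedAutomaton) (Y : List AbstractState) : List AbstractState :=
  (fun Z => A.grow Z)^[A.abstractStates.length] Y

/-- The abstract states at the start of a run. -/
def startStates (A : TimedAutomaton) : List AbstractState :=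
  A.abstractStates.filter fun c =>
    c.1 == A.init && (c.2.1.all (fun x => x == 0) && c.2.2.all fun x => x == 0)

/-- From the abstract states with integer part `m` of the time to those with `m + 1`. -/
def advance (A : TimedAutomaton) (Y : List AbstractState) : List AbstractState :=
  A.smallClosure (A.abstractStates.filter fun c' => Y.any fun c => A.ticks c c')

/-- The abstract states that are reachable at times with integer part `m`. -/
def level (A : TimedAutomaton) (m : ℕ) : List AbstractState :=
  (fun Y => A.advance Y)^[m] (A.smallClosure A.startStates)

/-- Whether the action `a` may occur in the phase `k`, that is, at the time `k / 2` if `k` is even,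
and at the times strictly between `(k - 1) / 2` and `(k + 1) / 2` if `k` is odd. -/
def observes (A : TimedAutomaton) (a k : ℕ) : Bool :=
  (A.level (k / 2)).any fun c =>
    decide (entry c.2.1 0 < entry c.2.1 1) == (k % 2 == 1) &&
      A.trans.any fun τ => τ.act == some a && c.enables τ

end TimedAutomaton

section Computability

variable {α : Type*} [Primcodable α]

@[fun_prop]
theorem primrec_entry {l : α → List ℕ} {i : α → ℕ} (hl : Primrec l) (hi : Primrec i) :
    Primrec fun a => entry (l a) (i a) := by
  unfold entry
  fun_prop

@[fun_prop]
theorem primrec_words {b n : α → ℕ} (hb : Primrec b) (hn : Primrec n) :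
    Primrec fun a => words (b a) (n a) := by
  unfold words
  fun_prop

@[fun_prop]
theorem primrec_sameOrder {N : α → ℕ} {x y : α → List ℕ} (hN : Primrec N) (hx : Primrec x)
    (hy : Primrec y) : Primrec fun a => sameOrder (N a) (x a) (y a) := by
  unfold sameOrder
  fun_prop

@[fun_prop]
theorem primrec_cmp_eval {c : α → Cmp} {l e : α → Bool} (hc : Primrec c) (hl : Primrec l)
    (he : Primrec e) : Primrec fun a => (c a).eval (l a) (e a) := by
  have : Finite Cmp := Finite.of_equiv _ Cmp.equivFin.symm
  exact (Primrec.dom_finite fun p : Cmp × Bool × Bool => p.1.eval p.2.1 p.2.2).comp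
    (hc.pair (hl.pair he))

@[fun_prop]
theorem primrec_maxConst {A : α → TimedAutomaton} (hA : Primrec A) :
    Primrec fun a => (A a).maxConst := by
  unfold TimedAutomaton.maxConst
  fun_prop

@[fun_prop]
theorem primrec_numItems {A : α → TimedAutomaton} (hA : Primrec A) :
    Primrec fun a => (A a).numItems := by
  unfold TimedAutomaton.numItems
  fun_prop

@[fun_prop]
theorem primrec_abstractStates {A : α → TimedAutomaton} (hA : Primrec A) :
    Primrec fun a => (A a).abstractStates := by
  unfold TimedAutomaton.abstractStates
  fun_prop

@[fun_prop]
theorem primrec_slides {A : α → TimedAutomaton} {c c' : α → AbstractState} (hA : Primrec A)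
    (hc : Primrec c) (hc' : Primrec c') : Primrec fun a => (A a).slides (c a) (c' a) := by
  unfold TimedAutomaton.slides
  fun_prop

@[fun_prop]
theorem primrec_ticks {A : α → TimedAutomaton} {c c' : α → AbstractState} (hA : Primrec A)
    (hc : Primrec c) (hc' : Primrec c') : Primrec fun a => (A a).ticks (c a) (c' a) := by
  unfold TimedAutomaton.ticks
  fun_prop

@[fun_prop]
theorem primrec_enables {c : α → AbstractState} {τ : α → Transition} (hc : Primrec c)
    (hτ : Primrec τ) : Primrec fun a => (c a).enables (τ a) := by
  unfold AbstractState.enables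
  fun_prop

@[fun_prop]
theorem primrec_fires {A : α → TimedAutomaton} {τ : α → Transition} {c c' : α → AbstractState}
    (hA : Primrec A) (hτ : Primrec τ) (hc : Primrec c) (hc' : Primrec c') :
    Primrec fun a => (A a).fires (τ a) (c a) (c' a) := by
  unfold TimedAutomaton.fires
  fun_prop

@[fun_prop]
theorem primrec_smallStep {A : α → TimedAutomaton} {c c' : α → AbstractState} (hA : Primrec A)
    (hc : Primrec c) (hc' : Primrec c') : Primrec fun a => (A a).smallStep (c a) (c' a) := by
  unfold TimedAutomaton.smallStep
  fun_prop

@[fun_prop]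
theorem primrec_grow {A : α → TimedAutomaton} {Y : α → List AbstractState} (hA : Primrec A)
    (hY : Primrec Y) : Primrec fun a => (A a).grow (Y a) := by
  unfold TimedAutomaton.grow
  fun_prop

@[fun_prop]
theorem primrec_smallClosure {A : α → TimedAutomaton} {Y : α → List AbstractState}
    (hA : Primrec A) (hY : Primrec Y) : Primrec fun a => (A a).smallClosure (Y a) := by
  unfold TimedAutomaton.smallClosure
  fun_prop

@[fun_prop]
theorem primrec_startStates {A : α → TimedAutomaton} (hA : Primrec A) :
    Primrec fun a => (A a).startStates := by
  unfold TimedAutomaton.startStates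
  fun_prop

@[fun_prop]
theorem primrec_advance {A : α → TimedAutomaton} {Y : α → List AbstractState} (hA : Primrec A)
    (hY : Primrec Y) : Primrec fun a => (A a).advance (Y a) := by
  unfold TimedAutomaton.advance
  fun_prop

@[fun_prop]
theorem primrec_level {A : α → TimedAutomaton} {m : α → ℕ} (hA : Primrec A) (hm : Primrec m) :
    Primrec fun a => (A a).level (m a) := by
  unfold TimedAutomaton.level
  fun_prop

@[fun_prop]
theorem primrec_observes {A : α → TimedAutomaton} {a k : α → ℕ} (hA : Primrec A) (ha : Primrec a)
    (hk : Primrec k) : Primrec fun x => (A x).observes (a x) (k x) := by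
  unfold TimedAutomaton.observes
  fun_prop

end Computability

/-! ### Time and the times of the last resets -/

/-- The constraint guard `g` holds at time `t` if `r c` is the time of the last reset of `c`. -/
def GuardHolds (g : List ClockConstraint) (t : ℝ) (r : ℕ → ℝ) : Prop :=
  ClockValuation.Satisfies (fun c => (t - r c).toNNReal) g

/-- Reset the clocks in `R` at time `t`. -/
def resetAt (r : ℕ → ℝ) (R : List ℕ) (t : ℝ) : ℕ → ℝ := fun c => if c ∈ R then t else r c

theorem ClockValuation.delay_zero (v : ClockValuation) : v.delay 0 = v := by
  funext c
  simp [ClockValuation.delay]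

namespace TimedAutomaton

/-- `A` can be in location `q` at time `t`, the clock `c` having been reset last at time `r c`. -/
inductive Visits (A : TimedAutomaton) : ℕ → ℝ → (ℕ → ℝ) → Prop
  | start : Visits A A.init 0 fun _ => 0
  | delay {q t r t'} : Visits A q t r → t ≤ t' → Visits A q t' r
  | jump {q t r τ} : Visits A q t r → τ ∈ A.trans → τ.src = q → GuardHolds τ.guard t r →
      Visits A τ.tgt t (resetAt r τ.resets t)

/-- The action `a` can occur at time `t`. -/
def Occurs (A : TimedAutomaton) (a : ℕ) (t : ℝ) : Prop :=
  ∃ r, ∃ τ ∈ A.trans, A.Visits τ.src t r ∧ GuardHolds τ.guard t r ∧ τ.act = some a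

theorem Visits.congr_loc {A : TimedAutomaton} {q q' t r} (h : A.Visits q t r) (hq : q = q') :
    A.Visits q' t r :=
  hq ▸ h

theorem Visits.reset_le {A : TimedAutomaton} {q t r} (h : A.Visits q t r) (c : ℕ) : r c ≤ t := by
  induction h with
  | start => exact le_rfl
  | delay _ ht ih => exact ih.trans ht
  | jump _ _ _ _ ih =>
    unfold resetAt
    split_ifs
    exacts [le_rfl, ih]

theorem Visits.reset_nonneg {A : TimedAutomaton} {q t r} (h : A.Visits q t r) (c : ℕ) :
    0 ≤ r c ∧ 0 ≤ t := by
  induction h with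
  | start => exact ⟨le_rfl, le_rfl⟩
  | delay _ ht ih => exact ⟨ih.1, ih.2.trans ht⟩
  | jump _ _ _ _ ih =>
    unfold resetAt
    split_ifs
    exacts [⟨ih.2, ih.2⟩, ih]

theorem Visits.isRun_of_isRunFrom {A : TimedAutomaton} {q t r} (h : A.Visits q t r) :
    ∀ ρ (p : ℝ≥0 × Option ℕ), A.IsRunFrom q (fun c => (t - r c).toNNReal) ρ →
      p ∈ timedTraceFrom t.toNNReal ρ → ∃ ρ', A.IsRun ρ' ∧ p ∈ timedTrace ρ' := by
  induction h with
  | start => exact fun ρ p h hp => ⟨ρ, by simpa [IsRun] using h, by simpa [timedTrace] using hp⟩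
  | @delay q t r t' h ht ih =>
    rintro (_ | ⟨⟨d, τ⟩, ρ⟩) p h' hp
    · simp [timedTraceFrom] at hp
    have ht0 : 0 ≤ t := (h.reset_nonneg 0).2
    refine ih ((d + (t' - t).toNNReal, τ) :: ρ) p ?_ ?_
    · have : ClockValuation.delay (fun c => (t - r c).toNNReal) (d + (t' - t).toNNReal) =
          ClockValuation.delay (fun c => (t' - r c).toNNReal) d := by
        funext c
        have hc := h.reset_le c
        apply NNReal.coe_injective
        simp only [ClockValuation.delay, NNReal.coe_add]
        rw [Real.coe_toNNReal _ (by linarith), Real.coe_toNNReal _ (by linarith),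
          Real.coe_toNNReal _ (by linarith)]
        ring
      simpa only [IsRunFrom, this] using h'
    · have : t.toNNReal + (d + (t' - t).toNNReal) = t'.toNNReal + d := by
        apply NNReal.coe_injective
        simp only [NNReal.coe_add]
        rw [Real.coe_toNNReal _ (by linarith), Real.coe_toNNReal _ (by linarith),
          Real.coe_toNNReal _ (by linarith)]
        ring
      simpa only [timedTraceFrom, this] using hp
  | @jump q t r τ h hτ hq hg ih =>
    intro ρ p h' hp
    refine ih ((0, τ) :: ρ) p ⟨hτ, hq, ?_, ?_⟩ ?_
    · rwa [ClockValuation.delay_zero]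
    · convert h' using 1
      funext c
      by_cases hc : c ∈ τ.resets <;> simp [ClockValuation.delay, ClockValuation.reset, resetAt, hc]
    · simp [timedTraceFrom, hp]

theorem Visits.occurs_of_mem_trace {A : TimedAutomaton} (ρ) : ∀ {q t r}, A.Visits q t r →
    A.IsRunFrom q (fun c => (t - r c).toNNReal) ρ →
      ∀ s a, (s, some a) ∈ timedTraceFrom t.toNNReal ρ → A.Occurs a s := by
  induction ρ with
  | nil => simp [timedTraceFrom]
  | cons p ρ ih =>
    obtain ⟨d, τ⟩ := p
    rintro q t r h ⟨hτ, rfl, hg, hρ⟩ s a hs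
    have ht0 : 0 ≤ t := (h.reset_nonneg 0).2
    have hv : A.Visits τ.src (t + d) r := h.delay (by simp)
    have hval : ClockValuation.delay (fun c => (t - r c).toNNReal) d =
        fun c => (t + d - r c).toNNReal := by
      funext c
      have hc := h.reset_le c
      have hd := d.2
      apply NNReal.coe_injective
      simp only [ClockValuation.delay, NNReal.coe_add]
      rw [Real.coe_toNNReal _ (by linarith), Real.coe_toNNReal _ (by have := d.coe_nonneg; linarith)]
      ring
    rw [hval] at hg hρ
    have htime : t.toNNReal + d = (t + d).toNNReal := by
      apply NNReal.coe_injective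
      simp only [NNReal.coe_add]
      rw [Real.coe_toNNReal _ (by linarith), Real.coe_toNNReal _ (by have := d.coe_nonneg; linarith)]
    rw [timedTraceFrom, htime, List.mem_cons] at hs
    rcases hs with hs | hs
    · simp only [Prod.mk.injEq] at hs
      refine ⟨r, τ, hτ, ?_, ?_, hs.2.symm⟩ <;> rw [hs.1, Real.coe_toNNReal _ (by
        have := d.coe_nonneg; linarith)]
      exacts [hv, hg]
    · refine ih (hv.jump hτ rfl hg) ?_ s a hs
      convert hρ using 1
      funext c
      by_cases hc : c ∈ τ.resets <;> simp [ClockValuation.reset, resetAt, hc]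

theorem mem_timestamp_iff {A : TimedAutomaton} {t : ℝ≥0} {a : ℕ} :
    (t, a) ∈ A.timestamp ↔ A.Occurs a t := by
  have key : (t, a) ∈ A.timestamp ↔ ∃ ρ, A.IsRun ρ ∧ (t, some a) ∈ timedTrace ρ := by
    simp only [timestamp, Set.mem_ofPred_eq, observableTrace, List.mem_filterMap, Option.map_eq_some_iff,
      Prod.mk.injEq, Prod.exists]
    constructor
    · rintro ⟨ρ, hρ, s, o, hs, b, rfl, rfl, rfl⟩
      exact ⟨ρ, hρ, hs⟩
    · rintro ⟨ρ, hρ, hs⟩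
      exact ⟨ρ, hρ, t, some a, hs, a, rfl, rfl, rfl⟩
  rw [key]
  constructor
  · rintro ⟨ρ, hρ, hs⟩
    exact Visits.occurs_of_mem_trace ρ .start (by simpa [IsRun] using hρ) t a
      (by simpa [timedTrace] using hs)
  · rintro ⟨r, τ, hτ, hv, hg, ha⟩
    refine hv.isRun_of_isRunFrom [(0, τ)] _ ⟨hτ, rfl, ?_, trivial⟩ ?_
    · rwa [ClockValuation.delay_zero]
    · simp [timedTraceFrom, ha]

theorem Occurs.nonneg {A : TimedAutomaton} {a t} (h : A.Occurs a t) : 0 ≤ t := by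
  obtain ⟨r, τ, -, hv, -⟩ := h
  exact (hv.reset_nonneg 0).2

end TimedAutomaton

/-! ### Guards in terms of differences -/

open Classical in
theorem Cmp.holds_toNNReal_iff (c : Cmp) {x : ℝ} (hx : 0 ≤ x) (b : ℕ) :
    c.Holds x.toNNReal b ↔ c.eval (decide (x < b)) (decide (x = b)) = true := by
  have hlt : x.toNNReal < (b : ℝ≥0) ↔ x < b := by
    rw [← NNReal.coe_lt_coe, Real.coe_toNNReal _ hx, NNReal.coe_natCast]
  have heq : x.toNNReal = (b : ℝ≥0) ↔ x = b := by
    rw [← NNReal.coe_inj, Real.coe_toNNReal _ hx, NNReal.coe_natCast]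
  cases c <;> simp only [Cmp.Holds, Cmp.eval, ge_iff_le, gt_iff_lt, Bool.or_eq_true,
    decide_eq_true_eq, Bool.not_eq_true', ← hlt, ← heq, decide_eq_false_iff_not, Bool.or_eq_false_iff,
    not_lt, ← le_iff_lt_or_eq]
  exact ⟨fun h => ⟨h.le, h.ne'⟩, fun h => lt_of_le_of_ne h.1 (Ne.symm h.2)⟩

open Classical in
theorem guardHolds_iff {g : List ClockConstraint} {t : ℝ} {r : ℕ → ℝ} (h : ∀ c, r c ≤ t) :
    GuardHolds g t r ↔ ∀ k ∈ g, k.cmp.eval (decide (t - r k.clock < k.bound))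
      (decide (t - r k.clock = k.bound)) = true :=
  forall₂_congr fun k _ => k.cmp.holds_toNNReal_iff (sub_nonneg.2 (h k.clock)) k.bound

/-! ### Time changes -/

/-- The time changes that commute with integer translations. -/
structure IsTimeChange (φ : ℝ → ℝ) : Prop where
  strictMono : StrictMono φ
  zero : φ 0 = 0
  add_natCast : ∀ x (n : ℕ), φ (x + n) = φ x + n

theorem IsTimeChange.guardHolds {φ : ℝ → ℝ} (hφ : IsTimeChange φ) {g : List ClockConstraint}
    {t : ℝ} {r : ℕ → ℝ} (h : ∀ c, r c ≤ t) (hg : GuardHolds g t r) :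
    GuardHolds g (φ t) fun c => φ (r c) := by
  rw [guardHolds_iff h] at hg
  rw [guardHolds_iff fun c => hφ.strictMono.monotone (h c)]
  intro k hk
  convert hg k hk using 3
  · rw [sub_lt_iff_lt_add', sub_lt_iff_lt_add', ← hφ.add_natCast, hφ.strictMono.lt_iff_lt]
  · rw [sub_eq_iff_eq_add', sub_eq_iff_eq_add', ← hφ.add_natCast, hφ.strictMono.injective.eq_iff]

theorem IsTimeChange.visits {φ : ℝ → ℝ} (hφ : IsTimeChange φ) {A : TimedAutomaton} {q t r}
    (h : A.Visits q t r) : A.Visits q (φ t) fun c => φ (r c) := by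
  induction h with
  | start => simpa [hφ.zero] using TimedAutomaton.Visits.start
  | delay _ ht ih => exact ih.delay (hφ.strictMono.monotone ht)
  | @jump q t r τ h hτ hq hg ih =>
    convert ih.jump hτ hq (hφ.guardHolds h.reset_le hg) using 1
    funext c
    simp only [resetAt]
    split_ifs <;> rfl

theorem IsTimeChange.occurs {φ : ℝ → ℝ} (hφ : IsTimeChange φ) {A : TimedAutomaton} {a t}
    (h : A.Occurs a t) : A.Occurs a (φ t) := by
  obtain ⟨r, τ, hτ, hv, hg, ha⟩ := h
  exact ⟨_, τ, hτ, hφ.visits hv, hφ.guardHolds hv.reset_le hg, ha⟩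

theorem isTimeChange_floor_add_rpow {α : ℝ} (hα : 0 < α) :
    IsTimeChange fun x => ⌊x⌋ + Int.fract x ^ α where
  strictMono x y h := by
    have hx1 : Int.fract x ^ α < 1 :=
      Real.rpow_lt_one (Int.fract_nonneg x) (Int.fract_lt_one x) hα
    have hy0 : 0 ≤ Int.fract y ^ α := Real.rpow_nonneg (Int.fract_nonneg y) α
    rcases (Int.floor_mono h.le).eq_or_lt with he | hl
    · have : Int.fract x < Int.fract y := by
        have h1 := Int.floor_add_fract x
        have h2 := Int.floor_add_fract y
        rw [he] at h1
        linarith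
      have := Real.rpow_lt_rpow (Int.fract_nonneg x) this hα
      simpa [he] using this
    · have : (⌊x⌋ : ℝ) + 1 ≤ ⌊y⌋ := by exact_mod_cast hl
      simp only
      linarith
  zero := by simp [hα.ne']
  add_natCast x n := by
    simp only [Int.floor_add_natCast, Int.fract_add_natCast, Int.cast_add, Int.cast_natCast]
    ring

/-- The time `x` belongs to the phase `k`: it is `k / 2` if `k` is even, and strictly between
`(k - 1) / 2` and `(k + 1) / 2` if `k` is odd. -/
def InPhase (k : ℕ) (x : ℝ) : Prop :=
  ∃ θ : ℝ, 0 < θ ∧ θ < 1 ∧ x = (k / 2 : ℕ) + if k % 2 = 1 then θ else 0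

theorem exists_inPhase {x : ℝ} (hx : 0 ≤ x) : ∃ k, InPhase k x := by
  have hfl : ((⌊x⌋₊ : ℕ) : ℝ) + Int.fract x = x := by
    have := Int.floor_add_fract x
    rwa [← natCast_floor_eq_intCast_floor hx] at this
  by_cases h : Int.fract x = 0
  · refine ⟨2 * ⌊x⌋₊, 1 / 2, by norm_num, by norm_num, ?_⟩
    rw [h] at hfl
    simpa using hfl.symm
  · refine ⟨2 * ⌊x⌋₊ + 1, Int.fract x, (Int.fract_nonneg x).lt_of_ne' h, Int.fract_lt_one x, ?_⟩
    have h1 : (2 * ⌊x⌋₊ + 1) / 2 = ⌊x⌋₊ := by omega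
    have h2 : (2 * ⌊x⌋₊ + 1) % 2 = 1 := by omega
    rw [h1, if_pos h2, hfl]

theorem TimedAutomaton.Occurs.of_inPhase {A : TimedAutomaton} {a k : ℕ} {x y : ℝ}
    (h : A.Occurs a x) (hx : InPhase k x) (hy : InPhase k y) : A.Occurs a y := by
  obtain ⟨θ, h0, h1, rfl⟩ := hx
  obtain ⟨θ', h0', h1', rfl⟩ := hy
  split_ifs at h ⊢ with hk
  · have hl : Real.log θ < 0 := Real.log_neg h0 h1
    have hl' : Real.log θ' < 0 := Real.log_neg h0' h1'
    have := (isTimeChange_floor_add_rpow (div_pos_of_neg_of_neg hl' hl)).occurs h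
    have hfl : ⌊((k / 2 : ℕ) : ℝ) + θ⌋ = (k / 2 : ℕ) := by
      rw [Int.floor_eq_iff]
      constructor <;> simp only [Int.cast_natCast] <;> linarith
    have hfr : Int.fract (((k / 2 : ℕ) : ℝ) + θ) = θ := by
      rw [Int.fract, hfl, Int.cast_natCast, add_sub_cancel_left]
    have hpow : θ ^ (Real.log θ' / Real.log θ) = θ' := by
      rw [Real.rpow_def_of_pos h0, mul_div_cancel₀ _ hl.ne, Real.exp_log h0']
    simpa only [hfl, hfr, hpow, Int.cast_natCast] using this
  · exact h

/-! ### Order patterns -/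

theorem mem_words {b n : ℕ} {l : List ℕ} : l ∈ words b n ↔ l.length = n ∧ ∀ x ∈ l, x < b := by
  induction n generalizing l with
  | zero =>
    simp only [words, Function.iterate_zero, id_eq, List.mem_singleton, List.length_eq_zero_iff]
    exact ⟨fun h => by simp [h], fun h => h.1⟩
  | succ n ih =>
    have : words b (n + 1) =
        (words b n).flatMap fun l => (List.range b).map fun x => x :: l :=
      Function.iterate_succ_apply' _ _ _
    rw [this]
    simp only [List.mem_flatMap, List.mem_map, List.mem_range, ih]
    constructor
    · rintro ⟨l, ⟨rfl, hl⟩, x, hx, rfl⟩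
      simpa using ⟨hx, hl⟩
    · cases l with
      | nil => simp
      | cons x l =>
        rintro ⟨h, hl⟩
        rw [List.forall_mem_cons] at hl
        exact ⟨l, ⟨by simpa using h, hl.2⟩, x, hl.1, rfl⟩

theorem entry_map_range {N i : ℕ} (f : ℕ → ℕ) (hi : i < N) :
    entry ((List.range N).map f) i = f i := by
  simp [entry, hi]

theorem map_range_mem_words {b N : ℕ} {f : ℕ → ℕ} (hf : ∀ i < N, f i < b) :
    (List.range N).map f ∈ words b N := by
  simpa [mem_words] using hf

theorem sameOrder_iff {N : ℕ} {x y : List ℕ} :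
    sameOrder N x y = true ↔ SameOrder N (entry x) (entry y) := by
  simp [sameOrder, SameOrder]

namespace SameOrder

variable {α β γ : Type*} {N : ℕ}

theorem symm [LT α] [LT β] {f : ℕ → α} {g : ℕ → β} (h : SameOrder N f g) : SameOrder N g f :=
  fun i hi j hj => (h i hi j hj).symm

theorem trans [LT α] [LT β] [LT γ] {f : ℕ → α} {g : ℕ → β} {h : ℕ → γ} (h₁ : SameOrder N f g)
    (h₂ : SameOrder N g h) : SameOrder N f h :=
  fun i hi j hj => (h₁ i hi j hj).trans (h₂ i hi j hj)

theorem of_eq [LT α] {f g : ℕ → α} (h : ∀ i < N, f i = g i) : SameOrder N f g :=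
  fun i hi j hj => by rw [h i hi, h j hj]

theorem mono [LT α] [LT β] {f : ℕ → α} {g : ℕ → β} {M : ℕ} (h : SameOrder M f g) (hN : N ≤ M) :
    SameOrder N f g :=
  fun i hi j hj => h i (hi.trans_le hN) j (hj.trans_le hN)

theorem comp [LT α] [LT β] {f : ℕ → α} {g : ℕ → β} {M : ℕ} (h : SameOrder M f g) {ρ : ℕ → ℕ}
    (hρ : ∀ i < N, ρ i < M) : SameOrder N (fun i => f (ρ i)) fun i => g (ρ i) :=
  fun i hi j hj => h _ (hρ i hi) _ (hρ j hj)

theorem eq_iff [LinearOrder α] [LinearOrder β] {f : ℕ → α} {g : ℕ → β} (h : SameOrder N f g)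
    {i j : ℕ} (hi : i < N) (hj : j < N) : f i = f j ↔ g i = g j := by
  rw [eq_iff_le_not_lt, eq_iff_le_not_lt, ← not_lt, ← not_lt, h i hi j hj, h j hj i hi]

end SameOrder

theorem exists_word_sameOrder {α : Type*} [LinearOrder α] (N : ℕ) (f : ℕ → α) :
    ∃ l ∈ words N N, SameOrder N f (entry l) := by
  set g : ℕ → ℕ := fun i => ((Finset.range N).filter fun j => f j < f i).card with hg
  have hlt : ∀ i < N, ∀ j, f i < f j → g i < g j := by
    intro i hi j hij
    refine Finset.card_lt_card ⟨fun k hk => ?_, fun hsub => ?_⟩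
    · rw [Finset.mem_filter] at hk ⊢
      exact ⟨hk.1, hk.2.trans hij⟩
    · have := hsub (Finset.mem_filter.2 ⟨Finset.mem_range.2 hi, hij⟩)
      exact lt_irrefl _ (Finset.mem_filter.1 this).2
  have hle : ∀ i j, f i ≤ f j → g i ≤ g j := fun i j hij =>
    Finset.card_le_card fun k hk => by
      rw [Finset.mem_filter] at hk ⊢
      exact ⟨hk.1, hk.2.trans_le hij⟩
  have hbound : ∀ i < N, g i < N := by
    intro i hi
    have : ((Finset.range N).filter fun j => f j < f i) ⊂ Finset.range N := by
      refine Finset.filter_ssubset.2 ⟨i, Finset.mem_range.2 hi, lt_irrefl _⟩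
    simpa using Finset.card_lt_card this
  refine ⟨(List.range N).map g, map_range_mem_words hbound, fun i hi j hj => ?_⟩
  rw [entry_map_range _ hi, entry_map_range _ hj]
  exact ⟨hlt i hi j, fun h => lt_of_not_ge fun h' => (hle j i h').not_gt h⟩

theorem SameOrder.exists_extension {N : ℕ} {f : ℕ → ℝ} {g : ℕ → ℕ} (h : SameOrder N f g)
    (h0 : f 0 = 0) (hN : 0 < N) (hf : ∀ i < N, f i < 1) {v : ℕ} (hv : g 0 ≤ v) :
    ∃ y : ℝ, 0 ≤ y ∧ y < 1 ∧ ∀ i < N, (f i < y ↔ g i < v) ∧ (y < f i ↔ v < g i) := by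
  by_cases hex : ∃ i < N, g i = v
  · obtain ⟨i, hi, rfl⟩ := hex
    refine ⟨f i, ?_, hf i hi, fun j hj => ⟨h j hj i hi, h i hi j hj⟩⟩
    rw [← h0]
    exact not_lt.1 fun hlt => hv.not_gt ((h i hi 0 hN).1 hlt)
  · push Not at hex
    obtain ⟨y, hlo, hhi⟩ := Order.exists_between_finsets
      (((Finset.range N).filter fun i => g i < v).image f)
      (insert 1 (((Finset.range N).filter fun i => v < g i).image f)) (by
        simp only [Finset.mem_image, Finset.mem_filter, Finset.mem_range, Finset.mem_insert]
        rintro _ ⟨i, ⟨hi, hiv⟩, rfl⟩ _ (rfl | ⟨j, ⟨hj, hjv⟩, rfl⟩)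
        · exact hf i hi
        · exact (h i hi j hj).2 (hiv.trans hjv))
    simp only [Finset.mem_image, Finset.mem_filter, Finset.mem_range, Finset.mem_insert,
      forall_eq_or_imp, forall_exists_index, and_imp] at hlo hhi
    have hlo' : ∀ i < N, g i < v → f i < y := fun i hi hiv => hlo _ i hi hiv rfl
    have hhi' : ∀ i < N, v < g i → y < f i := fun i hi hiv => hhi.2 _ i hi hiv rfl
    refine ⟨y, ?_, hhi.1, fun i hi => ⟨⟨fun hlt => ?_, hlo' i hi⟩, ⟨fun hlt => ?_, hhi' i hi⟩⟩⟩
    · rw [← h0]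
      exact (hlo' 0 hN (lt_of_le_of_ne hv (hex 0 hN))).le
    · exact (lt_or_gt_of_ne (hex i hi)).resolve_right fun h' => (hhi' i hi h').not_gt hlt
    · exact (lt_or_gt_of_ne (hex i hi)).resolve_left fun h' => (hlo' i hi h').not_gt hlt

/-! ### Closures on finite lists -/

theorem exists_chain_of_mem_iterate_filter {α : Type*} {U : List α} {R : List α → α → Bool}
    {Q : α → Prop} (hR : ∀ Y : List α, (∀ c ∈ Y, Q c) → ∀ c, R Y c = true → Q c) {Y : List α}
    (hY : ∀ c ∈ Y, Q c) (n : ℕ) : ∀ c ∈ (fun Z => U.filter fun c => R Z c)^[n] Y, Q c := by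
  induction n with
  | zero => exact hY
  | succ n ih =>
    rw [Function.iterate_succ_apply']
    exact fun c hc => hR _ ih c (List.mem_filter.1 hc).2

theorem filter_sublist_filter {α : Type*} {U : List α} {p q : α → Bool}
    (h : ∀ c ∈ U, p c = true → q c = true) : (U.filter p).Sublist (U.filter q) := by
  have : U.filter p = (U.filter q).filter p := by
    rw [List.filter_filter]
    refine List.filter_congr fun c hc => ?_
    cases hp : p c
    · simp
    · simp [h c hc hp]
  rw [this]
  exact List.filter_sublist

theorem iterate_filter_stable {α : Type*} {U : List α} {R : List α → α → Bool}
    (hmono : ∀ Y : List α, ∀ c ∈ Y, R Y c = true) {p : α → Bool} :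
    (fun Z => U.filter fun c => R Z c)^[U.length + 1] (U.filter p) =
      (fun Z => U.filter fun c => R Z c)^[U.length] (U.filter p) := by
  set F : List α → List α := fun Z => U.filter fun c => R Z c with hF
  have hfil : ∀ n, ∃ p' : α → Bool, F^[n] (U.filter p) = U.filter p' := by
    intro n
    cases n with
    | zero => exact ⟨p, rfl⟩
    | succ n => exact ⟨_, Function.iterate_succ_apply' F n _⟩
  have hsub : ∀ n, (F^[n] (U.filter p)).Sublist (F^[n + 1] (U.filter p)) := by
    intro n
    rw [Function.iterate_succ_apply']
    obtain ⟨p', hp'⟩ := hfil n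
    rw [hp']
    exact filter_sublist_filter fun c hc hc' => hmono _ c (List.mem_filter.2 ⟨hc, hc'⟩)
  have hstab := Nat.stabilises_of_monotone (f := fun n => (F^[n] (U.filter p)).length)
    (b := U.length) (n := U.length + 1) (monotone_nat_of_le_succ fun n => (hsub n).length_le)
    (fun n => by
      obtain ⟨p', hp'⟩ := hfil n
      simp only [hp']
      exact List.length_filter_le _ _)
    (fun n hn => by
      have := (hsub n).eq_of_length hn
      simp only [Function.iterate_succ_apply' F] at this ⊢
      rw [← this, ← this]) (Nat.le_succ _)
  exact ((hsub _).eq_of_length hstab.symm).symm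

/-! ### The abstraction is exact -/

/-- The fractional parts that an abstract state compares. -/
noncomputable def fractItems (t : ℝ) (r : ℕ → ℝ) : ℕ → ℝ
  | 0 => 0
  | 1 => Int.fract t
  | i + 2 => Int.fract (r i)

theorem fractItems_nonneg (t : ℝ) (r : ℕ → ℝ) (i : ℕ) : 0 ≤ fractItems t r i := by
  match i with
  | 0 => exact le_rfl
  | 1 => exact Int.fract_nonneg _
  | i + 2 => exact Int.fract_nonneg _

theorem fractItems_lt_one (t : ℝ) (r : ℕ → ℝ) (i : ℕ) : fractItems t r i < 1 := by
  match i with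
  | 0 => exact one_pos
  | 1 => exact Int.fract_lt_one _
  | i + 2 => exact Int.fract_lt_one _

theorem fractItems_of_time (t t' : ℝ) (r : ℕ → ℝ) (i : ℕ) :
    fractItems t' r i = if i = 1 then Int.fract t' else fractItems t r i := by
  match i with
  | 0 => rfl
  | 1 => rfl
  | i + 2 => simp [fractItems]

theorem fractItems_resetAt (t : ℝ) (r : ℕ → ℝ) (R : List ℕ) (i : ℕ) :
    fractItems t (resetAt r R t) i =
      fractItems t r (bif R.any fun c => c + 2 == i then 1 else i) := by
  match i with
  | 0 =>
    have : (R.any fun c => c + 2 == 0) = false := by simp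
    rw [this]
    rfl
  | 1 => simp [fractItems]
  | i + 2 =>
    by_cases h : i ∈ R
    · have : (R.any fun c => c + 2 == i + 2) = true := by simpa using h
      rw [this]
      simp [fractItems, resetAt, h]
    · have : (R.any fun c => c + 2 == i + 2) = false := by
        simpa using fun x hx (hxi : x = i) => h (hxi ▸ hx)
      rw [this]
      simp [fractItems, resetAt, h]

namespace TimedAutomaton

/-- The abstract state `c` describes the situation in location `q` at time `t`, with `r` the times
of the last resets. -/
structure Represents (A : TimedAutomaton) (m : ℕ) (c : AbstractState) (q : ℕ) (t : ℝ)
    (r : ℕ → ℝ) : Prop where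
  loc : c.1 = q
  floor : ⌊t⌋ = m
  order : SameOrder A.numItems (fractItems t r) (entry c.2.1)
  ints : ∀ i < A.numClocks, (entry c.2.2 i : ℤ) = min (⌊t⌋ - ⌊r i⌋) (A.maxConst + 1)

variable {A : TimedAutomaton} {m : ℕ} {c c' : AbstractState} {q : ℕ} {t t' : ℝ} {r : ℕ → ℝ}

theorem bound_le_maxConst {τ : Transition} (hτ : τ ∈ A.trans) {g : ClockConstraint}
    (hg : g ∈ τ.guard) : g.bound ≤ A.maxConst := by
  have key : ∀ (l : List ℕ), ∀ b ∈ l, b ≤ l.foldr (fun b m => max b m) 0 := by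
    intro l
    induction l with
    | nil => simp
    | cons x l ih =>
      intro b hb
      rcases List.mem_cons.1 hb with rfl | hb
      · exact le_max_left _ _
      · exact (ih b hb).trans (le_max_right _ _)
  exact key _ _ (List.mem_flatMap.2 ⟨τ, hτ, List.mem_map.2 ⟨g, hg, rfl⟩⟩)

theorem mem_abstractStates :
    c ∈ A.abstractStates ↔ c.1 < A.numLocs ∧ c.2.1 ∈ words A.numItems A.numItems ∧
      c.2.2 ∈ words (A.maxConst + 2) A.numClocks := by
  obtain ⟨q, x, k⟩ := c
  simp only [abstractStates, List.mem_flatMap, List.mem_range, List.mem_map, Prod.mk.injEq]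
  constructor
  · rintro ⟨q, hq, x, hx, k, hk, rfl, rfl, rfl⟩
    exact ⟨hq, hx, hk⟩
  · rintro ⟨hq, hx, hk⟩
    exact ⟨q, hq, x, hx, k, hk, rfl, rfl, rfl⟩

theorem exists_represents (hq : q < A.numLocs) (hr : ∀ i, r i ≤ t) (ht : ⌊t⌋ = m) :
    ∃ c ∈ A.abstractStates, A.Represents m c q t r := by
  obtain ⟨x, hx, hord⟩ := exists_word_sameOrder A.numItems (fractItems t r)
  have hnn : ∀ i, 0 ≤ ⌊t⌋ - ⌊r i⌋ := fun i => sub_nonneg.2 (Int.floor_mono (hr i))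
  refine ⟨(q, x, (List.range A.numClocks).map fun i =>
    (min (⌊t⌋ - ⌊r i⌋) (A.maxConst + 1)).toNat), mem_abstractStates.2 ⟨hq, hx,
      map_range_mem_words fun i _ => ?_⟩, rfl, ht, hord, fun i hi => ?_⟩
  · have := hnn i
    omega
  · rw [entry_map_range _ hi, Int.toNat_of_nonneg (le_min (hnn i) (by positivity))]

theorem Represents.slides_of (h : A.Represents m c q t r) (h' : A.Represents m c' q t' r)
    (htt : t < t') : A.slides c c' = true := by
  have hN : 0 < A.numItems ∧ 1 < A.numItems := by simp [numItems]
  set f : ℕ → ℝ := fun i => if i = A.numItems then Int.fract t' else fractItems t r i with hf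
  obtain ⟨l, hl, hord⟩ := exists_word_sameOrder (A.numItems + 1) f
  have hfract : Int.fract t < Int.fract t' := by
    have h1 := Int.floor_add_fract t
    have h2 := Int.floor_add_fract t'
    rw [h.floor] at h1
    rw [h'.floor] at h2
    linarith
  have hfi : ∀ i < A.numItems, f i = fractItems t r i := fun i hi => by simp [hf, hi.ne]
  have hfN : f A.numItems = Int.fract t' := by simp [hf]
  simp only [slides, Bool.and_eq_true, beq_iff_eq, List.any_eq_true, decide_eq_true_eq,
    sameOrder_iff, List.all_eq_true, List.mem_range]
  refine ⟨h.loc.trans h'.loc.symm, ⟨l, hl, ?_, ?_, ?_⟩, fun i hi => ?_⟩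
  · rw [← hord 1 (hN.2.trans (Nat.lt_succ_self _)) _ (Nat.lt_succ_self _), hfN, hfi 1 hN.2]
    exact hfract
  · refine (SameOrder.symm ?_).trans h.order
    exact (SameOrder.of_eq fun i hi => (hfi i hi).symm).trans (hord.mono (Nat.le_succ _))
  · refine SameOrder.trans (SameOrder.symm ?_) h'.order
    refine (SameOrder.of_eq fun i hi => ?_).trans ((hord.comp (N := A.numItems)
      (ρ := fun i => if i = 1 then A.numItems else i) fun i hi => ?_).trans
      (SameOrder.of_eq fun i hi => ?_))
    · rw [fractItems_of_time t t']
      split_ifs with h1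
      · exact hfN.symm
      · exact (hfi i hi).symm
    · split_ifs <;> omega
    · rw [entry_map_range _ hi]
      simp only [Bool.cond_eq_ite, beq_iff_eq]
      split_ifs <;> rfl
  · have h1 := h.ints i hi
    have h2 := h'.ints i hi
    rw [h.floor] at h1
    rw [h'.floor] at h2
    omega

theorem Represents.exists_of_slides (h : A.Represents m c q t r) (hs : A.slides c c' = true) :
    ∃ t', t ≤ t' ∧ A.Represents m c' q t' r := by
  have hN : 0 < A.numItems ∧ 1 < A.numItems := by simp [numItems]
  simp only [slides, Bool.and_eq_true, beq_iff_eq, List.any_eq_true, decide_eq_true_eq,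
    sameOrder_iff, List.all_eq_true, List.mem_range] at hs
  obtain ⟨hloc, ⟨l, hl, hlt, hord, hord'⟩, hint⟩ := hs
  have hfl := h.order.trans hord.symm
  have h0 : entry l 0 ≤ entry l 1 := not_lt.1 fun hc =>
    (fractItems_nonneg t r 1).not_gt ((hfl 1 hN.2 0 hN.1).2 hc)
  obtain ⟨y, hy0, hy1, hy⟩ := hfl.exists_extension rfl hN.1
    (fun i _ => fractItems_lt_one t r i) (h0.trans hlt.le)
  have hfloor : ⌊(m : ℝ) + y⌋ = m := by
    rw [Int.floor_eq_iff]
    constructor <;> simp only [Int.cast_natCast] <;> linarith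
  have hfract : Int.fract ((m : ℝ) + y) = y := by
    rw [Int.fract, hfloor, Int.cast_natCast, add_sub_cancel_left]
  refine ⟨m + y, ?_, hloc.symm.trans h.loc, hfloor, ?_, fun i hi => ?_⟩
  · have h1 := Int.floor_add_fract t
    rw [h.floor, Int.cast_natCast] at h1
    have h2 : Int.fract t < y := (hy 1 hN.2).1.2 hlt
    linarith
  · refine SameOrder.trans (fun i hi j hj => ?_) hord'
    rw [entry_map_range _ hi, entry_map_range _ hj, fractItems_of_time t, fractItems_of_time t _ r j,
      hfract]
    by_cases hi1 : i = 1 <;> by_cases hj1 : j = 1 <;> simp only [hi1, hj1, if_true, if_false,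
      beq_self_eq_true, lt_self_iff_false, beq_iff_eq, Bool.cond_eq_ite]
    · exact (hy j hj).2
    · exact (hy i hi).1
    · exact hfl i hi j hj
  · rw [hint i hi, h.ints i hi, hfloor, h.floor]

theorem fractItems_floor_succ (i : ℕ) :
    fractItems ((m : ℝ) + 1) r i = fractItems t r (if i = 1 then 0 else i) := by
  rw [fractItems_of_time t]
  split_ifs
  · simp [fractItems]
  · rfl

theorem Represents.ticks_iff (h : A.Represents m c q t r) :
    A.ticks c c' = true ↔ A.Represents (m + 1) c' q (m + 1) r := by
  have hN : 0 < A.numItems ∧ 1 < A.numItems := by simp [numItems]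
  have hfloor : ⌊(m : ℝ) + 1⌋ = m + 1 := by
    rw [Int.floor_add_one, Int.floor_natCast]
  have hord : SameOrder A.numItems (fractItems ((m : ℝ) + 1) r)
      (entry ((List.range A.numItems).map fun i =>
        bif i == 1 then entry c.2.1 0 else entry c.2.1 i)) := by
    refine (SameOrder.of_eq fun i _ => fractItems_floor_succ (t := t) i).trans
      ((h.order.comp (N := A.numItems) fun i hi => ?_).trans (SameOrder.of_eq fun i hi => ?_))
    · split_ifs <;> omega
    · rw [entry_map_range _ hi]
      simp only [Bool.cond_eq_ite, beq_iff_eq]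
      split_ifs <;> rfl
  have hint : ∀ i < A.numClocks, (entry c'.2.2 i = min (entry c.2.2 i + 1) (A.maxConst + 1) ↔
      (entry c'.2.2 i : ℤ) = min (⌊(m : ℝ) + 1⌋ - ⌊r i⌋) (A.maxConst + 1)) := by
    intro i hi
    have h1 := h.ints i hi
    rw [h.floor] at h1
    rw [hfloor]
    omega
  simp only [ticks, Bool.and_eq_true, beq_iff_eq, sameOrder_iff, List.all_eq_true, List.mem_range]
  constructor
  · rintro ⟨h1, h2, h3⟩
    exact ⟨h1.symm.trans h.loc, by simp, hord.trans h2,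
      fun i hi => (hint i hi).1 (h3 i hi)⟩
  · intro h'
    exact ⟨h.loc.trans h'.loc.symm, hord.symm.trans h'.order,
      fun i hi => (hint i hi).2 (h'.ints i hi)⟩

theorem Represents.fires_iff (h : A.Represents m c q t r) {τ : Transition} :
    A.fires τ c c' = true ↔ A.Represents m c' τ.tgt t (resetAt r τ.resets t) := by
  have hN : 0 < A.numItems ∧ 1 < A.numItems := by simp [numItems]
  have hord : SameOrder A.numItems (fractItems t (resetAt r τ.resets t))
      (entry ((List.range A.numItems).map fun i =>
        bif τ.resets.any fun r => r + 2 == i then entry c.2.1 1 else entry c.2.1 i)) := by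
    refine (SameOrder.of_eq fun i _ => fractItems_resetAt t r τ.resets i).trans
      ((h.order.comp (N := A.numItems) fun i hi => ?_).trans (SameOrder.of_eq fun i hi => ?_))
    · cases τ.resets.any fun r => r + 2 == i
      exacts [hi, hN.2]
    · rw [entry_map_range _ hi]
      cases τ.resets.any fun r => r + 2 == i <;> rfl
  have hint : ∀ i < A.numClocks, ((entry c'.2.2 i =
      bif τ.resets.any fun r => r == i then 0 else entry c.2.2 i) ↔
      (entry c'.2.2 i : ℤ) = min (⌊t⌋ - ⌊resetAt r τ.resets t i⌋) (A.maxConst + 1)) := by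
    intro i hi
    have h1 := h.ints i hi
    by_cases hR : i ∈ τ.resets
    · have : (τ.resets.any fun r => r == i) = true := by simpa using hR
      rw [this]
      simp only [resetAt, hR, if_true, cond_true, sub_self]
      omega
    · have : (τ.resets.any fun r => r == i) = false := by
        simpa using fun x hx (hxi : x = i) => hR (hxi ▸ hx)
      rw [this]
      simp only [resetAt, hR, if_false, cond_false, ← h1]
      omega
  simp only [fires, Bool.and_eq_true, beq_iff_eq, sameOrder_iff, List.all_eq_true, List.mem_range]
  constructor
  · rintro ⟨h1, h2, h3⟩
    exact ⟨h1.symm, h.floor, hord.trans h2, fun i hi => (hint i hi).1 (h3 i hi)⟩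
  · intro h'
    exact ⟨h'.loc.symm, hord.symm.trans h'.order, fun i hi => (hint i hi).2 (h'.ints i hi)⟩

theorem Represents.enables_iff (h : A.Represents m c q t r) (hr : ∀ i, r i ≤ t) (hA : A.IsENTA)
    {τ : Transition} (hτ : τ ∈ A.trans) :
    c.enables τ = true ↔ τ.src = q ∧ GuardHolds τ.guard t r := by
  classical
  simp only [AbstractState.enables, Bool.and_eq_true, beq_iff_eq, List.all_eq_true, h.loc,
    guardHolds_iff hr]
  refine and_congr_right fun _ => forall₂_congr fun g hg => ?_
  have hclock := hA.guard_lt τ hτ g hg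
  have hbound := bound_le_maxConst hτ hg
  have hint := h.ints _ hclock
  have hi1 : 1 < A.numItems := by simp [numItems]
  have hi2 : g.clock + 2 < A.numItems := by simp only [numItems]; omega
  have hlt := h.order 1 hi1 _ hi2
  have heq := h.order.eq_iff hi1 hi2
  simp only [fractItems] at hlt heq
  have ht := Int.floor_add_fract t
  have hrc := Int.floor_add_fract (r g.clock)
  have ht0 := Int.fract_nonneg t
  have hrc0 := Int.fract_nonneg (r g.clock)
  have ht1 := Int.fract_lt_one t
  have hrc1 := Int.fract_lt_one (r g.clock)
  have hdiff : t - r g.clock =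
      ((⌊t⌋ - ⌊r g.clock⌋ : ℤ) : ℝ) + (Int.fract t - Int.fract (r g.clock)) := by
    push_cast
    linarith
  have hk : ((entry c.2.2 g.clock : ℤ) < g.bound ↔ ⌊t⌋ - ⌊r g.clock⌋ < g.bound) ∧
      (entry c.2.2 g.clock = g.bound ↔ ⌊t⌋ - ⌊r g.clock⌋ = g.bound) := by omega
  rw [hdiff]
  generalize ⌊t⌋ - ⌊r g.clock⌋ = z at hk
  have hz : (z < g.bound → (z : ℝ) + 1 ≤ g.bound) ∧ ((g.bound : ℤ) < z → (g.bound : ℝ) + 1 ≤ z) :=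
    ⟨fun h => by exact_mod_cast h, fun h => by exact_mod_cast h⟩
  have hlt' : ((z : ℝ) + (Int.fract t - Int.fract (r g.clock)) < g.bound ↔
      z < g.bound ∨ z = g.bound ∧ Int.fract t < Int.fract (r g.clock)) := by
    rcases lt_trichotomy z g.bound with h1 | h1 | h1
    · have := hz.1 h1
      simp only [h1, true_or, iff_true]
      linarith
    · rw [h1, Int.cast_natCast]
      simp
    · have := hz.2 h1
      simp only [h1.not_gt, h1.ne', false_and, or_self, iff_false, not_lt]
      linarith
  have heq' : ((z : ℝ) + (Int.fract t - Int.fract (r g.clock)) = g.bound ↔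
      z = g.bound ∧ Int.fract t = Int.fract (r g.clock)) := by
    rcases lt_trichotomy z g.bound with h1 | h1 | h1
    · have := hz.1 h1
      simp only [h1.ne, false_and, iff_false]
      intro h
      linarith
    · rw [h1, Int.cast_natCast]
      simp [sub_eq_zero]
    · have := hz.2 h1
      simp only [h1.ne', false_and, iff_false]
      intro h
      linarith
  simp only [hlt', heq', ← hk.1, ← hk.2, hlt, heq, Bool.decide_or, Bool.decide_and, Nat.cast_lt,
    beq_eq_decide]

end TimedAutomaton

namespace TimedAutomaton

variable {A : TimedAutomaton} {m : ℕ} {c c' : AbstractState} {q : ℕ} {t t' : ℝ} {r : ℕ → ℝ}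

/-! ### Reachable abstract states -/

theorem forall_mem_smallClosure {Q : AbstractState → Prop} {Y : List AbstractState}
    (hY : ∀ c ∈ Y, Q c) (hQ : ∀ c c', Q c → A.smallStep c c' = true → Q c') :
    ∀ c ∈ A.smallClosure Y, Q c := by
  refine exists_chain_of_mem_iterate_filter (fun Y hY c hc => ?_) hY _
  simp only [Bool.or_eq_true, List.any_eq_true, beq_iff_eq, exists_eq_right] at hc
  rcases hc with hc | ⟨c', hc', hs⟩
  exacts [hY c hc, hQ c' c (hY c' hc') hs]

theorem grow_smallClosure (p : AbstractState → Bool) :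
    A.grow (A.smallClosure (A.abstractStates.filter p)) =
      A.smallClosure (A.abstractStates.filter p) := by
  have := iterate_filter_stable (U := A.abstractStates) (p := p)
    (R := fun Y c' => Y.any (fun c => c == c') || Y.any fun c => A.smallStep c c')
    (fun Y c hc => by simp [hc])
  rwa [Function.iterate_succ_apply'] at this

theorem subset_smallClosure {p : AbstractState → Bool} (hc : c ∈ A.abstractStates)
    (hp : p c = true) : c ∈ A.smallClosure (A.abstractStates.filter p) := by
  suffices ∀ n, c ∈ (fun Z => A.grow Z)^[n] (A.abstractStates.filter p) from this _
  intro n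
  induction n with
  | zero => exact List.mem_filter.2 ⟨hc, hp⟩
  | succ n ih =>
    rw [Function.iterate_succ_apply']
    exact List.mem_filter.2 ⟨hc, by simp [ih]⟩

theorem mem_smallClosure_of_smallStep {p : AbstractState → Bool}
    (hc : c ∈ A.smallClosure (A.abstractStates.filter p)) (hc' : c' ∈ A.abstractStates)
    (hs : A.smallStep c c' = true) : c' ∈ A.smallClosure (A.abstractStates.filter p) := by
  rw [← grow_smallClosure]
  refine List.mem_filter.2 ⟨hc', ?_⟩
  simp only [Bool.or_eq_true, List.any_eq_true]
  exact Or.inr ⟨c, hc, hs⟩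

theorem level_succ (m : ℕ) : A.level (m + 1) = A.advance (A.level m) :=
  Function.iterate_succ_apply' _ _ _

theorem level_eq_smallClosure (A : TimedAutomaton) (m : ℕ) :
    ∃ p, A.level m = A.smallClosure (A.abstractStates.filter p) := by
  cases m with
  | zero => exact ⟨_, rfl⟩
  | succ m => exact ⟨_, level_succ m⟩

theorem mem_level_of_smallStep (hc : c ∈ A.level m) (hc' : c' ∈ A.abstractStates)
    (hs : A.smallStep c c' = true) : c' ∈ A.level m := by
  obtain ⟨p, hp⟩ := A.level_eq_smallClosure m
  rw [hp] at hc ⊢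
  exact mem_smallClosure_of_smallStep hc hc' hs

theorem mem_level_of_ticks (hc : c ∈ A.level m) (hc' : c' ∈ A.abstractStates)
    (hs : A.ticks c c' = true) : c' ∈ A.level (m + 1) := by
  rw [level_succ]
  refine subset_smallClosure hc' ?_
  simp only [List.any_eq_true]
  exact ⟨c, hc, hs⟩

/-- The abstract state `c` describes a situation that `A` can reach. -/
def Realizable (A : TimedAutomaton) (m : ℕ) (c : AbstractState) : Prop :=
  ∃ q t r, A.Visits q t r ∧ A.Represents m c q t r

theorem Realizable.of_smallStep (hA : A.IsENTA) (h : A.Realizable m c)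
    (hs : A.smallStep c c' = true) : A.Realizable m c' := by
  obtain ⟨q, t, r, hv, hrep⟩ := h
  simp only [smallStep, Bool.or_eq_true, List.any_eq_true, Bool.and_eq_true] at hs
  rcases hs with hs | ⟨τ, hτ, hen, hf⟩
  · obtain ⟨t', ht', hrep'⟩ := hrep.exists_of_slides hs
    exact ⟨q, t', r, hv.delay ht', hrep'⟩
  · obtain ⟨hsrc, hg⟩ := (hrep.enables_iff hv.reset_le hA hτ).1 hen
    exact ⟨_, _, _, hv.jump hτ hsrc hg, hrep.fires_iff.1 hf⟩

theorem Realizable.of_ticks (h : A.Realizable m c) (hs : A.ticks c c' = true) :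
    A.Realizable (m + 1) c' := by
  obtain ⟨q, t, r, hv, hrep⟩ := h
  have ht : t ≤ m + 1 := by
    have := (Int.lt_floor_add_one t).le
    rwa [hrep.floor, Int.cast_natCast] at this
  exact ⟨q, m + 1, r, hv.delay ht, hrep.ticks_iff.1 hs⟩

theorem realizable_of_startStates (hc : c ∈ A.startStates) : A.Realizable 0 c := by
  simp only [startStates, List.mem_filter, Bool.and_eq_true, beq_iff_eq, List.all_eq_true] at hc
  obtain ⟨-, hloc, hx, hk⟩ := hc
  have hentry : ∀ l : List ℕ, (∀ x ∈ l, x = 0) → ∀ i, entry l i = 0 := by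
    intro l hl i
    by_cases hi : i < l.length
    · simpa [entry, hi] using hl _ (List.getElem_mem hi)
    · simp [entry, not_lt.1 hi]
  refine ⟨_, _, _, .start, hloc, by simp, fun i _ j _ => ?_, fun i _ => ?_⟩
  · have : ∀ i, fractItems 0 (fun _ => 0) i = 0 := fun i => by
      match i with
      | 0 => rfl
      | 1 => simp [fractItems]
      | i + 2 => simp [fractItems]
    simp [hentry _ hx, this]
  · rw [hentry _ hk]
    simp only [sub_self, Nat.cast_zero]
    omega

theorem realizable_of_mem_level (hA : A.IsENTA) (m : ℕ) : ∀ c ∈ A.level m, A.Realizable m c := by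
  induction m with
  | zero =>
    exact forall_mem_smallClosure (fun c => realizable_of_startStates)
      fun c c' h hs => h.of_smallStep hA hs
  | succ m ih =>
    rw [level_succ]
    refine forall_mem_smallClosure (fun c' hc' => ?_) fun c c' h hs => h.of_smallStep hA hs
    obtain ⟨c, hc, hs⟩ := List.any_eq_true.1 (List.mem_filter.1 hc').2
    exact (ih c hc).of_ticks hs

theorem exists_mem_level_of_le (hq : q < A.numLocs) (d : ℕ) : ∀ {m c t}, c ∈ A.level m →
    A.Represents m c q t r → (∀ i, r i ≤ t) → t ≤ t' → ⌊t'⌋ = (m + d : ℕ) →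
      ∃ c' ∈ A.level (m + d), A.Represents (m + d) c' q t' r := by
  induction d with
  | zero =>
    intro m c t hc h hr htt hfl
    rcases htt.eq_or_lt with rfl | hlt
    · exact ⟨c, hc, h⟩
    · obtain ⟨c', hc', h'⟩ := exists_represents hq (fun i => (hr i).trans htt) hfl
      refine ⟨c', mem_level_of_smallStep hc hc' ?_, h'⟩
      rw [smallStep, h.slides_of h' hlt, Bool.true_or]
  | succ d ih =>
    intro m c t hc h hr htt hfl
    have ht : t ≤ m + 1 := by
      have := (Int.lt_floor_add_one t).le
      rwa [h.floor, Int.cast_natCast] at this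
    have ht' : (m : ℝ) + 1 ≤ t' := by
      have := Int.floor_le t'
      rw [hfl] at this
      push_cast at this
      have := d.cast_nonneg (α := ℝ)
      linarith
    have hr' : ∀ i, r i ≤ (m : ℝ) + 1 := fun i => (hr i).trans ht
    obtain ⟨c', hc', h'⟩ := exists_represents (m := m + 1) hq hr' (by
      rw [Int.floor_add_one, Int.floor_natCast, Nat.cast_succ])
    have := ih (mem_level_of_ticks hc hc' (h.ticks_iff.2 h')) h' hr' ht'
      (by rw [hfl]; push_cast; ring)
    rwa [add_right_comm, add_assoc] at this

theorem Visits.exists_mem_level (hA : A.IsENTA) (h : A.Visits q t r) :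
    q < A.numLocs ∧ ∃ m, ∃ c ∈ A.level m, A.Represents m c q t r := by
  induction h with
  | start =>
    refine ⟨hA.init_lt, 0, (A.init, (List.range A.numItems).map fun _ => 0,
      (List.range A.numClocks).map fun _ => 0), subset_smallClosure (mem_abstractStates.2
        ⟨hA.init_lt, map_range_mem_words fun i hi => by omega, map_range_mem_words
          fun i _ => by omega⟩) ?_, rfl, by simp, fun i hi j hj => ?_, fun i hi => ?_⟩
    · simp
    · have : ∀ i, fractItems 0 (fun _ => 0) i = 0 := fun i => by
        match i with
        | 0 => rfl
        | 1 => simp [fractItems]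
        | i + 2 => simp [fractItems]
      rw [entry_map_range _ hi, entry_map_range _ hj, this, this]
      simp
    · rw [entry_map_range _ hi]
      simp only [sub_self, Nat.cast_zero]
      omega
  | @delay q t r t' hv htt ih =>
    obtain ⟨hq, m, c, hc, h⟩ := ih
    have hle : (m : ℤ) ≤ ⌊t'⌋ := by
      rw [← h.floor]
      exact Int.floor_mono htt
    refine ⟨hq, m + (⌊t'⌋ - m).toNat, exists_mem_level_of_le hq _ hc h hv.reset_le htt ?_⟩
    omega
  | @jump q t r τ hv hτ hsrc hg ih =>
    obtain ⟨hq, m, c, hc, h⟩ := ih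
    have htgt := hA.tgt_lt τ hτ
    obtain ⟨c', hc', h'⟩ := exists_represents htgt
      (hv.jump hτ hsrc hg).reset_le h.floor
    refine ⟨htgt, m, c', mem_level_of_smallStep hc hc' ?_, h'⟩
    simp only [smallStep, Bool.or_eq_true, List.any_eq_true, Bool.and_eq_true]
    exact Or.inr ⟨τ, hτ, (h.enables_iff hv.reset_le hA hτ).2 ⟨hsrc, hg⟩, h.fires_iff.2 h'⟩

theorem Represents.inPhase_iff (h : A.Represents m c q t r) {k : ℕ} :
    InPhase k t ↔ m = k / 2 ∧ (entry c.2.1 0 < entry c.2.1 1 ↔ k % 2 = 1) := by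
  have hN : 0 < A.numItems ∧ 1 < A.numItems := by simp [numItems]
  rw [← h.order 0 hN.1 1 hN.2]
  simp only [fractItems]
  have ht := Int.floor_add_fract t
  rw [h.floor, Int.cast_natCast] at ht
  constructor
  · rintro ⟨θ, h0, h1, hθ⟩
    have hfl : ⌊t⌋ = (k / 2 : ℕ) := by
      rw [Int.floor_eq_iff, hθ, Int.cast_natCast]
      split_ifs <;> constructor <;> linarith
    rw [h.floor] at hfl
    have hm : m = k / 2 := by exact_mod_cast hfl
    refine ⟨hm, ?_⟩
    rw [hm] at ht
    split_ifs at hθ with hk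
    · simp only [hk, iff_true]
      linarith
    · simp only [hk, iff_false, not_lt]
      linarith
  · rintro ⟨rfl, hk⟩
    by_cases hk1 : k % 2 = 1
    · exact ⟨Int.fract t, hk.2 hk1, Int.fract_lt_one t, by rw [if_pos hk1, ht]⟩
    · have : Int.fract t = 0 :=
        le_antisymm (not_lt.1 fun h => hk1 (hk.1 h)) (Int.fract_nonneg t)
      refine ⟨1 / 2, by norm_num, by norm_num, ?_⟩
      rw [if_neg hk1, ← this, ht]

theorem occurs_iff_observes (hA : A.IsENTA) {a k : ℕ} (hk : InPhase k t) :
    A.Occurs a t ↔ A.observes a k = true := by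
  simp only [observes, List.any_eq_true, Bool.and_eq_true, beq_iff_eq]
  constructor
  · rintro ⟨r, τ, hτ, hv, hg, ha⟩
    obtain ⟨-, m, c, hc, h⟩ := hv.exists_mem_level hA
    obtain ⟨rfl, hpar⟩ := h.inPhase_iff.1 hk
    refine ⟨c, hc, ?_, τ, hτ, ha, (h.enables_iff hv.reset_le hA hτ).2 ⟨rfl, hg⟩⟩
    rw [Bool.eq_iff_iff]
    simpa using hpar
  · rintro ⟨c, hc, hpar, τ, hτ, ha, hen⟩
    obtain ⟨q, t₀, r, hv, h⟩ := realizable_of_mem_level hA _ c hc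
    obtain ⟨rfl, hg⟩ := (h.enables_iff hv.reset_le hA hτ).1 hen
    refine Occurs.of_inPhase (x := t₀) ⟨r, τ, hτ, hv, hg, ha⟩ (h.inPhase_iff.2 ⟨rfl, ?_⟩) hk
    rw [Bool.eq_iff_iff] at hpar
    simpa using hpar

/-! ### Periodicity -/

/-- From this level on, the levels are periodic. -/
def preperiod (A : TimedAutomaton) : ℕ := 2 ^ A.abstractStates.length

/-- A period of the sequence of levels. -/
def period (A : TimedAutomaton) : ℕ := (2 ^ A.abstractStates.length).factorial

theorem period_pos (A : TimedAutomaton) : 0 < A.period := Nat.factorial_pos _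

theorem level_add_of_eq {i j : ℕ} (h : A.level i = A.level j) (n : ℕ) :
    A.level (i + n) = A.level (j + n) := by
  induction n with
  | zero => exact h
  | succ n ih => rw [← add_assoc, ← add_assoc, level_succ, level_succ, ih]

theorem level_add_period {m : ℕ} (hm : A.preperiod ≤ m) :
    A.level (m + A.period) = A.level m := by
  classical
  have hsub : ∀ m, A.level m ∈ A.abstractStates.sublists.toFinset := by
    intro m
    obtain ⟨p, hp⟩ := A.level_eq_smallClosure m
    rw [List.mem_toFinset, List.mem_sublists, hp, ← grow_smallClosure]
    exact List.filter_sublist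
  obtain ⟨i, hi, j, hj, hij, heq⟩ := Finset.exists_ne_map_eq_of_card_lt_of_maps_to
    (s := Finset.range (A.preperiod + 1)) (t := A.abstractStates.sublists.toFinset) (f := A.level)
    (by
      rw [Finset.card_range, Nat.lt_succ_iff]
      refine (List.toFinset_card_le _).trans ?_
      rw [List.length_sublists]
      rfl)
    (fun m _ => hsub m)
  wlog hlt : i < j generalizing i j
  · exact this j hj i hi hij.symm heq.symm (lt_of_le_of_ne (not_lt.1 hlt) hij.symm)
  rw [Finset.mem_range, Nat.lt_succ_iff] at hi hj
  have hstep : ∀ n, i ≤ n → A.level (n + (j - i)) = A.level n := by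
    intro n hn
    have := level_add_of_eq heq (n - i)
    rw [Nat.add_sub_cancel' hn] at this
    rw [this]
    congr 1
    omega
  have hmul : ∀ e n, i ≤ n → A.level (n + (j - i) * e) = A.level n := by
    intro e
    induction e with
    | zero => simp
    | succ e ih =>
      intro n hn
      rw [Nat.mul_succ, ← add_assoc, hstep _ (hn.trans (Nat.le_add_right _ _)), ih n hn]
  obtain ⟨e, he⟩ : (j - i) ∣ A.period := Nat.dvd_factorial (by omega) ((Nat.sub_le _ _).trans hj)
  rw [he]
  exact hmul e m (hi.trans hm)

theorem observes_add_period {a k : ℕ} (hk : 2 * A.preperiod ≤ k) :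
    A.observes a (k + 2 * A.period) = A.observes a k := by
  have h1 : (k + 2 * A.period) / 2 = k / 2 + A.period := by omega
  have h2 : (k + 2 * A.period) % 2 = k % 2 := by omega
  rw [observes, observes, h1, h2, level_add_period (by omega)]

end TimedAutomaton

section Computability

variable {α : Type*} [Primcodable α]

@[fun_prop]
theorem primrec_preperiod {A : α → TimedAutomaton} (hA : Primrec A) :
    Primrec fun a => (A a).preperiod := by
  unfold TimedAutomaton.preperiod
  fun_prop

@[fun_prop]
theorem primrec_period {A : α → TimedAutomaton} (hA : Primrec A) :
    Primrec fun a => (A a).period := by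
  unfold TimedAutomaton.period
  fun_prop

end Computability

/-! ### Bouquets in which all flowers have the same shape -/

/-- The location with number `j` of the flower `a`, if the stalks have `s + 1` edges and the loops
`l + 1` edges. -/
def flowerLoc (s l a j : ℕ) : ℕ := 1 + a * (s + 1 + l) + j

/-- The source of the edge with number `j` of the flower `a`. -/
def flowerSrc (s l a j : ℕ) : ℕ := bif j == 0 then 0 else flowerLoc s l a (j - 1)

/-- The target of the edge with number `j` of the flower `a`. -/
def flowerTgt (s l a j : ℕ) : ℕ := flowerLoc s l a (bif j == s + 1 + l then s else j)

/-- The edge with number `j` of the flower `a`. The only clock is reset at the end of the stalk and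
at the end of the loop. -/
def flowerEdge (s l : ℕ) (G : ℕ → ℕ → List ClockConstraint) (a j : ℕ) : Transition :=
  ⟨flowerSrc s l a j, some a, G a j, bif j == s || j == s + 1 + l then [0] else [],
    flowerTgt s l a j⟩

/-- The bouquet with `n` flowers and with guards `G`. -/
def bouquet (n s l : ℕ) (G : ℕ → ℕ → List ClockConstraint) : TimedAutomaton :=
  ⟨1 + n * (s + 1 + l), 0, n, 1, (List.range n).flatMap fun a =>
    (List.range (s + 1 + (l + 1))).map fun j => flowerEdge s l G a j⟩

@[fun_prop]
theorem primrec_bouquet {α : Type*} [Primcodable α] {n s l : α → ℕ}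
    {G : α → ℕ → ℕ → List ClockConstraint} (hn : Primrec n) (hs : Primrec s) (hl : Primrec l)
    (hG : Primrec fun p : α × ℕ × ℕ => G p.1 p.2.1 p.2.2) :
    Primrec fun x => bouquet (n x) (s x) (l x) (G x) := by
  have hloc : ∀ (u v w x : α × ℕ × ℕ → ℕ), Primrec u → Primrec v → Primrec w → Primrec x →
      Primrec fun p => flowerLoc (u p) (v p) (w p) (x p) := by
    intro u v w x hu hv hw hx
    unfold flowerLoc
    fun_prop
  have hsrc : Primrec fun p : α × ℕ × ℕ => flowerSrc (s p.1) (l p.1) p.2.1 p.2.2 := by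
    have := hloc (fun p => s p.1) (fun p => l p.1) (fun p => p.2.1) (fun p => p.2.2 - 1)
      (by fun_prop) (by fun_prop) (by fun_prop) (by fun_prop)
    unfold flowerSrc
    fun_prop
  have htgt : Primrec fun p : α × ℕ × ℕ => flowerTgt (s p.1) (l p.1) p.2.1 p.2.2 :=
    hloc (fun p => s p.1) (fun p => l p.1) (fun p => p.2.1)
      (fun p => bif p.2.2 == s p.1 + 1 + l p.1 then s p.1 else p.2.2)
      (by fun_prop) (by fun_prop) (by fun_prop) (by fun_prop)
  have hedge : Primrec fun p : α × ℕ × ℕ => flowerEdge (s p.1) (l p.1) (G p.1) p.2.1 p.2.2 := by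
    unfold flowerEdge
    fun_prop
  have hcomp : Primrec fun p : (α × ℕ) × ℕ => flowerEdge (s p.1.1) (l p.1.1) (G p.1.1) p.1.2 p.2 :=
    hedge.comp (f := fun p : α × ℕ × ℕ => flowerEdge (s p.1) (l p.1) (G p.1) p.2.1 p.2.2)
      (g := fun p : (α × ℕ) × ℕ => (p.1.1, p.1.2, p.2)) (by fun_prop)
  unfold bouquet
  fun_prop

section Bouquet

variable {n s l : ℕ} {G : ℕ → ℕ → List ClockConstraint} {a a' j j' : ℕ}

theorem mem_bouquet_trans {τ : Transition} :
    τ ∈ (bouquet n s l G).trans ↔ ∃ a < n, ∃ j ≤ s + 1 + l, flowerEdge s l G a j = τ := by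
  simp only [bouquet, List.mem_flatMap, List.mem_map, List.mem_range, Nat.lt_succ_iff, ← add_assoc]

theorem flowerLoc_inj (hj : j < s + 1 + l) (hj' : j' < s + 1 + l)
    (h : flowerLoc s l a j = flowerLoc s l a' j') : a = a' ∧ j = j' := by
  have h' : a * (s + 1 + l) + j = a' * (s + 1 + l) + j' := by
    unfold flowerLoc at h
    omega
  have h1 := congrArg (· / (s + 1 + l)) h'
  have h2 := congrArg (· % (s + 1 + l)) h'
  have hpos : 0 < s + 1 + l := by omega
  simp only [Nat.mul_comm _ (s + 1 + l), Nat.mul_add_div hpos, Nat.div_eq_of_lt hj,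
    Nat.div_eq_of_lt hj', add_zero] at h1
  simp only [Nat.mul_comm _ (s + 1 + l), Nat.mul_add_mod, Nat.mod_eq_of_lt hj,
    Nat.mod_eq_of_lt hj'] at h2
  exact ⟨h1, h2⟩

theorem flowerLoc_lt (ha : a < n) (hj : j < s + 1 + l) :
    flowerLoc s l a j < 1 + n * (s + 1 + l) := by
  have : (a + 1) * (s + 1 + l) ≤ n * (s + 1 + l) := Nat.mul_le_mul_right _ ha
  rw [add_mul] at this
  unfold flowerLoc
  omega

theorem flowerSrc_zero : flowerSrc s l a 0 = 0 := rfl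

theorem flowerSrc_succ (j : ℕ) : flowerSrc s l a (j + 1) = flowerLoc s l a j := rfl

theorem flowerTgt_of_lt (hj : j < s + 1 + l) : flowerTgt s l a j = flowerSrc s l a (j + 1) := by
  have : (j == s + 1 + l) = false := by simpa using hj.ne
  rw [flowerSrc_succ, flowerTgt, this, cond_false]

theorem flowerTgt_last : flowerTgt s l a (s + 1 + l) = flowerSrc s l a (s + 1) := by
  rw [flowerTgt, flowerSrc_succ, beq_self_eq_true, cond_true]

theorem flowerSrc_inj (hj : j ≤ s + 1 + l) (hj' : j' ≤ s + 1 + l)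
    (h : flowerSrc s l a j = flowerSrc s l a' j') : j = j' ∧ (j = 0 ∨ a = a') := by
  cases j with
  | zero =>
    cases j' with
    | zero => exact ⟨rfl, Or.inl rfl⟩
    | succ j' =>
      rw [flowerSrc_zero, flowerSrc_succ, flowerLoc] at h
      omega
  | succ j =>
    cases j' with
    | zero =>
      rw [flowerSrc_zero, flowerSrc_succ, flowerLoc] at h
      omega
    | succ j' =>
      rw [flowerSrc_succ, flowerSrc_succ] at h
      obtain ⟨rfl, rfl⟩ := flowerLoc_inj hj hj' h
      exact ⟨rfl, Or.inr rfl⟩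

theorem flowerSrc_lt (ha : a < n) (hj : j ≤ s + 1 + l) :
    flowerSrc s l a j < 1 + n * (s + 1 + l) := by
  cases j with
  | zero =>
    rw [flowerSrc_zero]
    omega
  | succ j => exact flowerLoc_lt ha hj

theorem flowerTgt_lt (ha : a < n) (hj : j ≤ s + 1 + l) :
    flowerTgt s l a j < 1 + n * (s + 1 + l) := by
  rcases hj.eq_or_lt with rfl | hj
  · rw [flowerTgt_last]
    exact flowerSrc_lt ha (by omega)
  · rw [flowerTgt_of_lt hj]
    exact flowerSrc_lt ha hj

theorem bouquet_isENTA (hG : ∀ a j, ∀ g ∈ G a j, g.clock = 0) : (bouquet n s l G).IsENTA where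
  init_lt := by simp [bouquet]
  src_lt τ hτ := by
    obtain ⟨a, ha, j, hj, rfl⟩ := mem_bouquet_trans.1 hτ
    exact flowerSrc_lt ha hj
  tgt_lt τ hτ := by
    obtain ⟨a, ha, j, hj, rfl⟩ := mem_bouquet_trans.1 hτ
    exact flowerTgt_lt ha hj
  act_lt τ hτ b hb := by
    obtain ⟨a, ha, j, hj, rfl⟩ := mem_bouquet_trans.1 hτ
    obtain rfl : a = b := Option.some.inj hb
    exact ha
  guard_lt τ hτ g hg := by
    obtain ⟨a, ha, j, hj, rfl⟩ := mem_bouquet_trans.1 hτ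
    rw [hG a j g hg]
    exact one_pos
  resets_lt τ hτ c hc := by
    obtain ⟨a, ha, j, hj, rfl⟩ := mem_bouquet_trans.1 hτ
    simp only [flowerEdge] at hc
    cases hb : j == s || j == s + 1 + l <;> simp_all [bouquet]

/-- An automaton is deterministic if source and action determine the transition. -/
theorem TimedAutomaton.IsDeterministic.of_src_act {A : TimedAutomaton}
    (hsil : ∀ τ ∈ A.trans, τ.act ≠ none)
    (hdet : ∀ τ ∈ A.trans, ∀ τ' ∈ A.trans, τ.src = τ'.src → τ.act = τ'.act → τ = τ') :
    A.IsDeterministic where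
  no_silent := hsil
  unique_run := by
    suffices ∀ ρ ρ' q v t, A.IsRunFrom q v ρ → A.IsRunFrom q v ρ' →
        timedTraceFrom t ρ = timedTraceFrom t ρ' → ρ = ρ' from
      fun ρ ρ' h h' heq => this ρ ρ' _ _ _ h h' heq
    intro ρ
    induction ρ with
    | nil =>
      rintro (_ | ⟨p, ρ'⟩) q v t h h' heq
      · rfl
      · simp [timedTraceFrom] at heq
    | cons p ρ ih =>
      obtain ⟨d, τ⟩ := p
      rintro (_ | ⟨⟨d', τ'⟩, ρ'⟩) q v t h h' heq
      · simp [timedTraceFrom] at heq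
      · simp only [timedTraceFrom, List.cons.injEq, Prod.mk.injEq, add_right_inj] at heq
        obtain ⟨⟨rfl, hact⟩, heq⟩ := heq
        obtain ⟨hτ, hsrc, -, hρ⟩ := h
        obtain ⟨hτ', hsrc', -, hρ'⟩ := h'
        obtain rfl := hdet τ hτ τ' hτ' (hsrc.trans hsrc'.symm) hact
        rw [ih ρ' _ _ _ hρ hρ' heq]

theorem bouquet_isDeterministic : (bouquet n s l G).IsDeterministic := by
  refine .of_src_act (fun τ hτ => ?_) fun τ hτ τ' hτ' hsrc hact => ?_
  · obtain ⟨a, ha, j, hj, rfl⟩ := mem_bouquet_trans.1 hτ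
    exact Option.some_ne_none a
  · obtain ⟨a, ha, j, hj, rfl⟩ := mem_bouquet_trans.1 hτ
    obtain ⟨a', ha', j', hj', rfl⟩ := mem_bouquet_trans.1 hτ'
    obtain rfl : a = a' := Option.some.inj hact
    rw [(flowerSrc_inj hj hj' hsrc).1]

theorem isPath_map_range {e : ℕ → Transition} {v : ℕ → ℕ} (m : ℕ) :
    ∀ i, (∀ j < m, (e (i + j)).src = v j ∧ (e (i + j)).tgt = v (j + 1)) →
      IsPath (v 0) ((List.range m).map fun j => e (i + j)) (v m) := by
  induction m generalizing v with
  | zero => exact fun _ _ => rfl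
  | succ m ih =>
    intro i h
    rw [List.range_succ_eq_map, List.map_cons, List.map_map]
    refine ⟨(h 0 (Nat.succ_pos m)).1, ?_⟩
    rw [(h 0 (Nat.succ_pos m)).2]
    have := ih (v := fun j => v (j + 1)) (i + 1) fun j hj => by
      rw [add_assoc, add_comm 1 j]
      exact h (j + 1) (Nat.succ_lt_succ hj)
    convert this using 3 with j
    simp only [Function.comp_apply, Nat.succ_eq_add_one]
    rw [add_assoc, add_comm 1 j]

theorem flowerLocs_bouquet :
    flowerLocs ((List.range (s + 1)).map fun j => flowerEdge s l G a j)
      ((List.range (l + 1)).map fun i => flowerEdge s l G a (s + 1 + i)) =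
      (List.range (s + 1 + l)).map fun j => flowerLoc s l a j := by
  have hdrop : ((List.range (l + 1)).map fun i => flowerEdge s l G a (s + 1 + i)).dropLast =
      (List.range l).map fun i => flowerEdge s l G a (s + 1 + i) := by
    rw [List.range_succ, List.map_append, List.map_singleton, List.dropLast_concat]
  rw [flowerLocs, hdrop, show List.range (s + 1 + l) = _ from List.range_add, List.map_append,
    List.map_append, List.map_map, List.map_map, List.map_map]
  congr 1 <;> refine List.map_congr_left fun j hj => ?_ <;> rw [List.mem_range] at hj
  · exact flowerTgt_of_lt (by omega)
  · exact flowerTgt_of_lt (by omega)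

theorem bouquet_isFlower :
    IsFlower 0 a ((List.range (s + 1)).map fun j => flowerEdge s l G a j)
      ((List.range (l + 1)).map fun i => flowerEdge s l G a (s + 1 + i)) where
  stalk_ne_nil := by simp
  path := by
    refine ⟨flowerSrc s l a (s + 1), ?_, ?_⟩
    · have := isPath_map_range (e := flowerEdge s l G a) (v := flowerSrc s l a) (s + 1) 0
        fun j hj => by
          rw [zero_add]
          exact ⟨rfl, flowerTgt_of_lt (by omega)⟩
      simpa [flowerSrc_zero] using this
    · have := isPath_map_range (e := flowerEdge s l G a)
        (v := fun i => if i = l + 1 then flowerSrc s l a (s + 1) else flowerSrc s l a (s + 1 + i))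
        (l + 1) (s + 1) fun i hi => by
          refine ⟨?_, ?_⟩
          · rw [if_neg hi.ne]
            rfl
          · split_ifs with h
            · obtain rfl : i = l := by omega
              exact flowerTgt_last
            · exact flowerTgt_of_lt (by omega)
      simpa using this
  label τ hτ := by
    simp only [List.mem_append, List.mem_map] at hτ
    rcases hτ with ⟨j, -, rfl⟩ | ⟨j, -, rfl⟩ <;> rfl
  simple := by
    rw [flowerLocs_bouquet, List.nodup_cons]
    constructor
    · simp [flowerLoc]
    · exact List.nodup_range.map fun j j' h => by simpa [flowerLoc] using h

theorem bouquet_isBouquet : (bouquet n s l G).IsBouquet := by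
  refine ⟨fun a => (List.range (s + 1)).map fun j => flowerEdge s l G a j,
    fun a => (List.range (l + 1)).map fun i => flowerEdge s l G a (s + 1 + i),
    fun a _ => bouquet_isFlower, fun a _ b _ hab => ?_, fun τ => ?_, fun q hq => ?_⟩
  · rw [flowerLocs_bouquet, flowerLocs_bouquet]
    intro q hqa hqb
    simp only [List.mem_map, List.mem_range] at hqa hqb
    obtain ⟨j, hj, rfl⟩ := hqa
    obtain ⟨j', hj', h⟩ := hqb
    exact hab (flowerLoc_inj hj' hj h).1.symm
  · simp only [bouquet, List.range_add, List.mem_flatMap, List.mem_range, List.map_append,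
      List.map_map, Function.comp_def]
  · simp only [flowerLocs_bouquet, List.mem_map, List.mem_range]
    rcases Nat.eq_zero_or_pos q with h | h
    · exact Or.inl h
    · have hq' : q < 1 + n * (s + 1 + l) := hq
      have hpos : 0 < s + 1 + l := by omega
      refine Or.inr ⟨(q - 1) / (s + 1 + l), ?_, (q - 1) % (s + 1 + l), Nat.mod_lt _ hpos, ?_⟩
      · rw [Nat.div_lt_iff_lt_mul hpos]
        change q - 1 < n * _
        omega
      · have := Nat.div_add_mod (q - 1) (s + 1 + l)
        rw [Nat.mul_comm] at this
        unfold flowerLoc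
        omega

end Bouquet

/-! ### Phases -/

/-- The point of the phase `k` with fractional part `θ` or zero. -/
noncomputable def phasePoint (θ : ℝ) (k : ℕ) : ℝ := (k / 2 : ℕ) + if k % 2 = 1 then θ else 0

theorem inPhase_add {p d : ℕ} {x y : ℝ} (hx : InPhase p x) (hy : InPhase d y)
    (h : p % 2 = 0 ∨ d % 2 = 0) : InPhase (p + d) (x + y) := by
  obtain ⟨θ, h0, h1, rfl⟩ := hx
  obtain ⟨η, h0', h1', rfl⟩ := hy
  have hdiv : (p + d) / 2 = p / 2 + d / 2 := by omega
  by_cases hd : d % 2 = 1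
  · have hp : ¬ p % 2 = 1 := by omega
    refine ⟨η, h0', h1', ?_⟩
    rw [if_neg hp, if_pos hd, if_pos (by omega), hdiv]
    push_cast
    ring
  · refine ⟨θ, h0, h1, ?_⟩
    have : (p + d) % 2 = p % 2 := by omega
    rw [if_neg hd, hdiv, this]
    push_cast
    ring

section PhasePoint

variable {θ : ℝ}

theorem inPhase_phasePoint (h0 : 0 < θ) (h1 : θ < 1) (k : ℕ) : InPhase k (phasePoint θ k) :=
  ⟨θ, h0, h1, rfl⟩

theorem phasePoint_nonneg (h0 : 0 < θ) (k : ℕ) : 0 ≤ phasePoint θ k := by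
  unfold phasePoint
  split_ifs <;> positivity

theorem phasePoint_mono (h0 : 0 < θ) (h1 : θ < 1) {k k' : ℕ} (h : k ≤ k') :
    phasePoint θ k ≤ phasePoint θ k' := by
  unfold phasePoint
  rcases (Nat.div_le_div_right (c := 2) h).eq_or_lt with he | hl
  · rw [he]
    split_ifs <;> first | linarith | omega
  · have : ((k / 2 : ℕ) : ℝ) + 1 ≤ (k' / 2 : ℕ) := by exact_mod_cast hl
    split_ifs <;> linarith

theorem inPhase_phasePoint_sub (h0 : 0 < θ) (h1 : θ < 1) {p k : ℕ} (hpk : p ≤ k)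
    (h : p % 2 = 0 ∨ k % 2 = 1) : InPhase (k - p) (phasePoint θ k - phasePoint θ p) := by
  refine ⟨θ, h0, h1, ?_⟩
  have hdiv : k / 2 = (k - p) / 2 + p / 2 := by omega
  unfold phasePoint
  rw [hdiv]
  push_cast
  split_ifs <;> first | omega | ring

end PhasePoint

/-- The guard saying that the time since the last reset is in the phase `d`. -/
def phaseGuard (d : ℕ) : List ClockConstraint :=
  bif d % 2 == 1 then [⟨0, .gt, d / 2⟩, ⟨0, .lt, d / 2 + 1⟩] else [⟨0, .eq, d / 2⟩]

theorem guardHolds_phaseGuard {d : ℕ} {t : ℝ} {r : ℕ → ℝ} (h : ∀ c, r c ≤ t) :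
    GuardHolds (phaseGuard d) t r ↔ InPhase d (t - r 0) := by
  rw [guardHolds_iff h, phaseGuard]
  by_cases hd : d % 2 = 1
  · simp only [hd, beq_self_eq_true, cond_true, List.forall_mem_cons, List.not_mem_nil,
      false_imp_iff, implies_true, and_true, Cmp.eval, Bool.not_eq_true', Bool.or_eq_false_iff,
      decide_eq_false_iff_not, decide_eq_true_eq, InPhase, if_true]
    constructor
    · rintro ⟨⟨h1, h2⟩, h3⟩
      have := lt_of_le_of_ne (not_lt.1 h1) (Ne.symm h2)
      push_cast at h3
      exact ⟨t - r 0 - (d / 2 : ℕ), by linarith, by linarith, by ring⟩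
    · rintro ⟨θ, h0, h1, hθ⟩
      rw [hθ]
      push_cast
      exact ⟨⟨by linarith, by linarith⟩, by linarith⟩
  · have hb : (d % 2 == 1) = false := by simpa using hd
    simp only [hb, cond_false, List.forall_mem_cons, List.not_mem_nil, false_imp_iff, implies_true,
      and_true, Cmp.eval, decide_eq_true_eq, InPhase, hd, if_false, add_zero]
    exact ⟨fun h => ⟨1 / 2, by norm_num, by norm_num, h⟩, fun ⟨_, _, _, h⟩ => h⟩

/-- The guard for an optional phase, unsatisfiable if there is none. -/
def optionalGuard (o : Option ℕ) : List ClockConstraint :=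
  (o.map fun d => phaseGuard d).getD [⟨0, .lt, 0⟩]

theorem guardHolds_optionalGuard {o : Option ℕ} {t : ℝ} {r : ℕ → ℝ} (h : ∀ c, r c ≤ t) :
    GuardHolds (optionalGuard o) t r ↔ ∃ d, o = some d ∧ InPhase d (t - r 0) := by
  cases o with
  | none =>
    simp only [optionalGuard, Option.map_none, Option.getD_none, guardHolds_iff h, reduceCtorEq,
      false_and, exists_false, iff_false]
    intro hc
    have := hc _ List.mem_cons_self
    have h0 := h 0
    simp only [Cmp.eval, decide_eq_true_eq, Nat.cast_zero] at this
    linarith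
  | some d => simp [optionalGuard, guardHolds_phaseGuard h]

theorem clock_of_mem_optionalGuard {o : Option ℕ} : ∀ g ∈ optionalGuard o, g.clock = 0 := by
  cases o with
  | none => simp [optionalGuard]
  | some d =>
    simp only [optionalGuard, phaseGuard, Option.map_some, Option.getD_some]
    cases d % 2 == 1 <;> simp

/-! ### A flower for an ultimately periodic set of phases -/

/-- The first number below `B` that satisfies the condition `p`. -/
def firstBelow (B : ℕ) (p : ℕ → Bool) : Option ℕ := ((List.range B).filter fun k => p k).head?

theorem firstBelow_eq_some {B k : ℕ} {p : ℕ → Bool} (h : firstBelow B p = some k) :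
    k < B ∧ p k = true := by
  have := List.mem_filter.1 (List.mem_of_mem_head? (Option.mem_def.2 h))
  exact ⟨List.mem_range.1 this.1, this.2⟩

theorem exists_firstBelow {B k : ℕ} {p : ℕ → Bool} (hk : k < B) (hp : p k = true) :
    ∃ k' ≤ k, firstBelow B p = some k' := by
  rw [firstBelow, List.head?_filter]
  rcases h : (List.range B).find? fun k => p k with - | k'
  · rw [List.find?_eq_none] at h
    exact absurd hp (h k (List.mem_range.2 hk))
  · refine ⟨k', not_lt.1 fun hlt => ?_, rfl⟩
    have := (List.find?_range_eq_some.1 h).2.2 k hlt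
    simp [hp] at this

section Flower

/-- The phase at which the clock is reset, in the period `[M, s)`: an even phase of the set `S`
if there is one, else an odd one, else `s`. -/
def pivot (S : ℕ → Bool) (M s : ℕ) : ℕ :=
  (firstBelow s fun k => decide (M ≤ k) && (S k && k % 2 == 0)).getD
    ((firstBelow s fun k => decide (M ≤ k) && S k).getD s)

/-- The next phase of `S` from `x` on. -/
def nextPhase (S : ℕ → Bool) (B x : ℕ) : Option ℕ := firstBelow B fun k => decide (x ≤ k) && S k

/-- The guard of the edge with number `j` of the flower for the set `S` of phases, which has the
period `l + 1` from `M` on. -/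
def flowerGuard (S : ℕ → Bool) (M l j : ℕ) : List ClockConstraint :=
  optionalGuard <|
    bif decide (j ≤ M + l + 1) then
      nextPhase S (M + l + 1 + (l + 1)) (min j (pivot S M (M + l + 1)))
    else
      (nextPhase S (M + l + 1 + (l + 1)) (pivot S M (M + l + 1) + (j - (M + l + 1)))).map fun k =>
        k - pivot S M (M + l + 1)

variable {S : ℕ → Bool} {M l : ℕ}

theorem nextPhase_eq_some {B x k : ℕ} (h : nextPhase S B x = some k) :
    x ≤ k ∧ k < B ∧ S k = true := by
  have := firstBelow_eq_some h
  simp only [Bool.and_eq_true, decide_eq_true_eq] at this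
  exact ⟨this.2.1, this.1, this.2.2⟩

theorem exists_nextPhase {B x k : ℕ} (hx : x ≤ k) (hk : k < B) (hS : S k = true) :
    ∃ k' ≤ k, nextPhase S B x = some k' :=
  exists_firstBelow hk (by simp [hx, hS])

theorem nextPhase_self {B x : ℕ} (hx : x < B) (hS : S x = true) : nextPhase S B x = some x := by
  obtain ⟨k, hk, h⟩ := exists_nextPhase le_rfl hx hS
  rwa [le_antisymm hk (nextPhase_eq_some h).1] at h

theorem eq_of_periodic (hS : ∀ k, M ≤ k → S (k + (l + 1)) = S k) {k : ℕ} (hk : M ≤ k) (e : ℕ) :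
    S (k + (l + 1) * e) = S k := by
  induction e with
  | zero => rfl
  | succ e ih => rw [Nat.mul_succ, ← add_assoc, hS _ (hk.trans (Nat.le_add_right _ _)), ih]

theorem exists_in_period (hS : ∀ k, M ≤ k → S (k + (l + 1)) = S k) {k : ℕ} (hk : M ≤ k) :
    ∃ k₀ e, M ≤ k₀ ∧ k₀ < M + l + 1 ∧ k = k₀ + (l + 1) * e ∧ S k = S k₀ := by
  have hk' : k = M + (k - M) % (l + 1) + (l + 1) * ((k - M) / (l + 1)) := by
    have := Nat.mod_add_div (k - M) (l + 1)
    omega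
  refine ⟨M + (k - M) % (l + 1), (k - M) / (l + 1), Nat.le_add_right _ _, ?_, hk', ?_⟩
  · have := Nat.mod_lt (k - M) (show 0 < l + 1 by omega)
    omega
  · conv_lhs => rw [hk']
    exact eq_of_periodic hS (Nat.le_add_right _ _) _

theorem pivot_spec (hS : ∀ k, M ≤ k → S (k + (l + 1)) = S k) (hl : (l + 1) % 2 = 0) :
    (pivot S M (M + l + 1) = M + l + 1 ∧ ∀ k, M ≤ k → S k = false) ∨
      (M ≤ pivot S M (M + l + 1) ∧ pivot S M (M + l + 1) < M + l + 1 ∧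
        S (pivot S M (M + l + 1)) = true ∧
        ∀ k, M ≤ k → S k = true → pivot S M (M + l + 1) % 2 = 0 ∨ k % 2 = 1) := by
  unfold pivot
  rcases h : firstBelow (M + l + 1) fun k => decide (M ≤ k) && (S k && k % 2 == 0) with - | p
  · have hodd : ∀ k, M ≤ k → S k = true → k % 2 = 1 := by
      intro k hk hSk
      obtain ⟨k₀, e, hM, hlt, hke, hk₀⟩ := exists_in_period hS hk
      by_contra hne
      have hpar : k₀ % 2 = 0 := by
        obtain ⟨w, hw⟩ := Nat.dvd_of_mod_eq_zero hl
        rw [hw, mul_assoc] at hke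
        omega
      obtain ⟨k', -, h'⟩ := exists_firstBelow (B := M + l + 1)
        (p := fun k => decide (M ≤ k) && (S k && k % 2 == 0)) hlt (by simp [hM, ← hk₀, hSk, hpar])
      rw [h] at h'
      exact Option.some_ne_none _ h'.symm
    rcases h2 : firstBelow (M + l + 1) fun k => decide (M ≤ k) && S k with - | p
    · refine Or.inl ⟨rfl, fun k hk => ?_⟩
      by_contra hne
      obtain ⟨k₀, e, hM, hlt, hke, hk₀⟩ := exists_in_period hS hk
      obtain ⟨k', -, h'⟩ := exists_firstBelow (B := M + l + 1)
        (p := fun k => decide (M ≤ k) && S k) hlt (by simpa [hM, ← hk₀] using hne)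
      rw [h2] at h'
      exact Option.some_ne_none _ h'.symm
    · have := firstBelow_eq_some h2
      simp only [Bool.and_eq_true, decide_eq_true_eq] at this
      exact Or.inr ⟨this.2.1, this.1, this.2.2, fun k hk hSk => Or.inr (hodd k hk hSk)⟩
  · have := firstBelow_eq_some h
    simp only [Bool.and_eq_true, decide_eq_true_eq, beq_iff_eq] at this
    exact Or.inr ⟨this.2.1, this.1, this.2.2.1, fun k _ _ => Or.inl this.2.2.2⟩

/-- What is known about the time `x` of the last reset when the edge with number `j` comes next. -/
def Ready (S : ℕ → Bool) (M l j : ℕ) (x : ℝ) : Prop :=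
  (j ≤ M + l + 1 → x = 0) ∧
    (M + l + 1 < j → S (pivot S M (M + l + 1)) = true ∧ pivot S M (M + l + 1) < M + l + 1 ∧
      ∃ e, InPhase (pivot S M (M + l + 1) + (l + 1) * e) x)

theorem Ready.fire (hS : ∀ k, M ≤ k → S (k + (l + 1)) = S k) (hl : (l + 1) % 2 = 0) {j : ℕ}
    {t : ℝ} {r : ℕ → ℝ} (h : Ready S M l j (r 0)) (hr : ∀ c, r c ≤ t)
    (hj : j ≤ M + l + 1 + (l + 1)) (hg : GuardHolds (flowerGuard S M l j) t r) :
    (∃ k, S k = true ∧ InPhase k t) ∧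
      (j = M + l + 1 ∨ j = M + l + 1 + (l + 1) → Ready S M l (M + l + 1 + 1) t) := by
  obtain ⟨d, hd, hph⟩ := (guardHolds_optionalGuard hr).1 hg
  rcases le_or_gt j (M + l + 1) with hjs | hjs
  · rw [decide_eq_true hjs, cond_true] at hd
    rw [h.1 hjs, sub_zero] at hph
    obtain ⟨hle, hlt, hSd⟩ := nextPhase_eq_some hd
    refine ⟨⟨d, hSd, hph⟩, fun hj' => ⟨fun hc => by omega, fun _ => ?_⟩⟩
    obtain rfl : j = M + l + 1 := by omega
    rcases pivot_spec hS hl with ⟨hp, hnone⟩ | ⟨hMp, hps, hSp, hpar⟩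
    · rw [hp, min_self] at hle
      rw [hnone d (by omega)] at hSd
      exact absurd hSd Bool.false_ne_true
    · rw [min_eq_right hps.le, nextPhase_self (by omega) hSp] at hd
      rw [← Option.some.inj hd] at hph
      exact ⟨hSp, hps, 0, by simpa using hph⟩
  · rw [decide_eq_false (not_le.2 hjs), cond_false] at hd
    obtain ⟨hSp, hps, e, he⟩ := h.2 hjs
    rcases pivot_spec hS hl with ⟨hp, hnone⟩ | ⟨hMp, -, -, hpar⟩
    · rw [hnone _ (by omega)] at hSp
      exact absurd hSp Bool.false_ne_true
    obtain ⟨k, hk, rfl⟩ := Option.map_eq_some_iff.1 hd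
    obtain ⟨hle, hlt, hSk⟩ := nextPhase_eq_some hk
    set p := pivot S M (M + l + 1) with hp
    have hev : (l + 1) * e % 2 = 0 := by rw [Nat.mul_mod, hl, Nat.zero_mul, Nat.zero_mod]
    have hpk : InPhase (p + (l + 1) * e + (k - p)) t := by
      have := inPhase_add he hph (by
        rcases hpar k (by omega) hSk with h1 | h1
        · omega
        · rcases hpar p hMp hSp with h2 | h2 <;> omega)
      rwa [add_sub_cancel] at this
    have hsum : p + (l + 1) * e + (k - p) = k + (l + 1) * e := by omega
    rw [hsum] at hpk
    refine ⟨⟨_, (eq_of_periodic hS (by omega) e).trans hSk, hpk⟩,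
      fun hj' => ⟨fun hc => by omega, fun _ => ⟨hSp, hps, e + 1, ?_⟩⟩⟩
    have hlast : p + (j - (M + l + 1)) = p + (l + 1) := by omega
    rw [hlast, nextPhase_self (by omega) ((hS p hMp).trans hSp)] at hk
    rw [← Option.some.inj hk] at hpk
    convert hpk using 1
    ring

end Flower

section Computability

variable {α : Type*} [Primcodable α]

@[fun_prop]
theorem primrec_optionalGuard {o : α → Option ℕ} (ho : Primrec o) :
    Primrec fun a => optionalGuard (o a) := by
  unfold optionalGuard phaseGuard
  fun_prop

@[fun_prop]
theorem primrec_firstBelow {B : α → ℕ} {p : α → ℕ → Bool} (hB : Primrec B)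
    (hp : Primrec fun x : α × ℕ => p x.1 x.2) : Primrec fun a => firstBelow (B a) (p a) := by
  unfold firstBelow
  fun_prop

@[fun_prop]
theorem primrec_nextPhase {S : α → ℕ → Bool} {B x : α → ℕ}
    (hS : Primrec fun p : α × ℕ => S p.1 p.2) (hB : Primrec B) (hx : Primrec x) :
    Primrec fun a => nextPhase (S a) (B a) (x a) := by
  unfold nextPhase
  fun_prop

@[fun_prop]
theorem primrec_pivot {S : α → ℕ → Bool} {M s : α → ℕ}
    (hS : Primrec fun p : α × ℕ => S p.1 p.2) (hM : Primrec M) (hs : Primrec s) :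
    Primrec fun a => pivot (S a) (M a) (s a) := by
  unfold pivot
  fun_prop

@[fun_prop]
theorem primrec_flowerGuard {S : α → ℕ → Bool} {M l j : α → ℕ}
    (hS : Primrec fun p : α × ℕ => S p.1 p.2) (hM : Primrec M) (hl : Primrec l) (hj : Primrec j) :
    Primrec fun a => flowerGuard (S a) (M a) (l a) (j a) := by
  unfold flowerGuard
  fun_prop

end Computability

/-! ### The timestamp of the bouquet -/

section BouquetSemantics

variable {n M l : ℕ} {S : ℕ → ℕ → Bool}

/-- The bouquet whose flower `a` realizes the set `S a` of phases, which has the period `l + 1`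
from `M` on. -/
def periodicBouquet (n M l : ℕ) (S : ℕ → ℕ → Bool) : TimedAutomaton :=
  bouquet n (M + l + 1) l fun a j => flowerGuard (S a) M l j

theorem resetAt_flowerEdge {s l a j : ℕ} {G : ℕ → ℕ → List ClockConstraint} {r : ℕ → ℝ} {t : ℝ} :
    resetAt r (flowerEdge s l G a j).resets t 0 =
      if j = s ∨ j = s + 1 + l then t else r 0 := by
  simp only [resetAt, flowerEdge]
  by_cases h : j = s ∨ j = s + 1 + l
  · have hb : (j == s || j == s + 1 + l) = true := by simpa using h
    simp [hb, h]
  · have hb : (j == s || j == s + 1 + l) = false := by simpa using h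
    simp [hb, h]

theorem ready_of_visits (hS : ∀ a k, M ≤ k → S a (k + (l + 1)) = S a k) (hl : (l + 1) % 2 = 0)
    {q : ℕ} {t : ℝ} {r : ℕ → ℝ} (h : (periodicBouquet n M l S).Visits q t r) :
    ∀ a j, j ≤ M + l + 1 + (l + 1) → q = flowerSrc (M + l + 1) l a j →
      Ready (S a) M l j (r 0) := by
  induction h with
  | start =>
    intro a j hj hq
    obtain ⟨rfl, -⟩ := flowerSrc_inj (s := M + l + 1) (l := l) (a := a) (a' := a) (j := j) (j' := 0)
      (by omega) (by omega) hq.symm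
    exact ⟨fun _ => rfl, fun h => by omega⟩
  | delay _ _ ih => exact ih
  | @jump q t r τ hv hτ hsrc hg ih =>
    obtain ⟨b, hb, i, hi, rfl⟩ := mem_bouquet_trans.1 hτ
    intro a j hj hq
    have hready := ih b i (by omega) hsrc.symm
    have hfire := hready.fire (hS b) hl hv.reset_le (by omega) hg
    rw [resetAt_flowerEdge]
    change flowerTgt _ _ _ _ = _ at hq
    rcases hi.eq_or_lt with rfl | hi
    · rw [flowerTgt_last] at hq
      obtain ⟨rfl, hab⟩ := flowerSrc_inj (by omega) (by omega) hq
      obtain rfl : b = a := hab.resolve_left (by omega)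
      rw [if_pos (Or.inr rfl)]
      exact hfire.2 (Or.inr (by omega))
    · rw [flowerTgt_of_lt hi] at hq
      obtain ⟨rfl, hab⟩ := flowerSrc_inj (by omega) (by omega) hq
      obtain rfl : b = a := hab.resolve_left (by omega)
      by_cases his : i = M + l + 1
      · subst his
        rw [if_pos (Or.inl rfl)]
        exact hfire.2 (Or.inl rfl)
      · rw [if_neg (by omega)]
        exact ⟨fun h => hready.1 (by omega), fun h => hready.2 (by omega)⟩

theorem exists_phase_of_occurs (hS : ∀ a k, M ≤ k → S a (k + (l + 1)) = S a k)
    (hl : (l + 1) % 2 = 0) {a : ℕ} {t : ℝ} (h : (periodicBouquet n M l S).Occurs a t) :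
    a < n ∧ ∃ k, S a k = true ∧ InPhase k t := by
  obtain ⟨r, τ, hτ, hv, hg, ha⟩ := h
  obtain ⟨b, hb, j, hj, rfl⟩ := mem_bouquet_trans.1 hτ
  obtain rfl : b = a := Option.some.inj ha
  have hready := ready_of_visits hS hl hv b j (by omega) rfl
  exact ⟨hb, (hready.fire (hS b) hl hv.reset_le (by omega) hg).1⟩

section Realization

variable {θ : ℝ} {a : ℕ}

theorem edge_mem (ha : a < n) {j : ℕ} (hj : j ≤ M + l + 1 + (l + 1)) :
    flowerEdge (M + l + 1) l (fun a j => flowerGuard (S a) M l j) a j ∈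
      (periodicBouquet n M l S).trans :=
  mem_bouquet_trans.2 ⟨a, ha, j, by omega, rfl⟩

theorem guardHolds_stalk (h0 : 0 < θ) (h1 : θ < 1) {j k : ℕ} (hj : j ≤ M + l + 1) {r : ℕ → ℝ}
    (hr : ∀ c, r c ≤ phasePoint θ k) (hr0 : r 0 = 0)
    (hk : nextPhase (S a) (M + l + 1 + (l + 1)) (min j (pivot (S a) M (M + l + 1))) = some k) :
    GuardHolds (flowerGuard (S a) M l j) (phasePoint θ k) r := by
  rw [flowerGuard, decide_eq_true hj, cond_true, hk, guardHolds_optionalGuard hr, hr0, sub_zero]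
  exact ⟨k, rfl, inPhase_phasePoint h0 h1 k⟩

theorem guardHolds_loop (h0 : 0 < θ) (h1 : θ < 1) {i k e : ℕ} {r : ℕ → ℝ}
    (hr : ∀ c, r c ≤ phasePoint θ (k + (l + 1) * e)) (hl : (l + 1) % 2 = 0)
    (hr0 : r 0 = phasePoint θ (pivot (S a) M (M + l + 1) + (l + 1) * e))
    (hpar : pivot (S a) M (M + l + 1) % 2 = 0 ∨ k % 2 = 1)
    (hk : nextPhase (S a) (M + l + 1 + (l + 1)) (pivot (S a) M (M + l + 1) + (i + 1)) = some k) :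
    GuardHolds (flowerGuard (S a) M l (M + l + 1 + (i + 1))) (phasePoint θ (k + (l + 1) * e)) r := by
  have hj : ¬ M + l + 1 + (i + 1) ≤ M + l + 1 := by omega
  rw [flowerGuard, decide_eq_false hj, cond_false, Nat.add_sub_cancel_left, hk,
    guardHolds_optionalGuard hr, hr0]
  have hle := (nextPhase_eq_some hk).1
  have hev : (l + 1) * e % 2 = 0 := by rw [Nat.mul_mod, hl, Nat.zero_mul, Nat.zero_mod]
  refine ⟨_, rfl, ?_⟩
  have := inPhase_phasePoint_sub h0 h1 (p := pivot (S a) M (M + l + 1) + (l + 1) * e)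
    (k := k + (l + 1) * e) (by omega) (by omega)
  rwa [Nat.add_sub_add_right] at this

theorem visits_stalk (h0 : 0 < θ) (h1 : θ < 1) (ha : a < n) (j : ℕ) : ∀ k, j ≤ M + l + 1 →
    nextPhase (S a) (M + l + 1 + (l + 1)) (min j (pivot (S a) M (M + l + 1))) = some k →
      ∃ r, r 0 = 0 ∧ (periodicBouquet n M l S).Visits (flowerSrc (M + l + 1) l a j)
        (phasePoint θ k) r := by
  induction j with
  | zero =>
    intro k _ _
    exact ⟨_, rfl, TimedAutomaton.Visits.start.delay (phasePoint_nonneg h0 k)⟩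
  | succ j ih =>
    intro k hj hk
    obtain ⟨hle, hlt, hSk⟩ := nextPhase_eq_some hk
    obtain ⟨k', hk', hnext⟩ := exists_nextPhase
      (x := min j (pivot (S a) M (M + l + 1))) (by omega) hlt hSk
    obtain ⟨r, hr0, hv⟩ := ih k' (by omega) hnext
    refine ⟨_, ?_, ((hv.jump (edge_mem ha (by omega)) rfl
      (guardHolds_stalk h0 h1 (by omega) hv.reset_le hr0 hnext)).delay
        (phasePoint_mono h0 h1 hk')).congr_loc ?_⟩
    · rw [resetAt_flowerEdge, if_neg (by omega), hr0]
    · exact flowerTgt_of_lt (by omega)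

/-- The set `S` of phases is not bounded, and `pivot` is one of its large elements. -/
structure HasPivot (S : ℕ → Bool) (M l : ℕ) : Prop where
  le : M ≤ pivot S M (M + l + 1)
  lt : pivot S M (M + l + 1) < M + l + 1
  mem : S (pivot S M (M + l + 1)) = true
  parity : ∀ k, M ≤ k → S k = true → pivot S M (M + l + 1) % 2 = 0 ∨ k % 2 = 1

theorem visits_loop_of_start (h0 : 0 < θ) (h1 : θ < 1) (ha : a < n) (hp : HasPivot (S a) M l)
    (hl : (l + 1) % 2 = 0) {e : ℕ}
    (hstart : ∃ r, r 0 = phasePoint θ (pivot (S a) M (M + l + 1) + (l + 1) * e) ∧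
      (periodicBouquet n M l S).Visits (flowerSrc (M + l + 1) l a (M + l + 1 + 1))
        (phasePoint θ (pivot (S a) M (M + l + 1) + (l + 1) * e)) r)
    (i : ℕ) : ∀ k, i ≤ l →
      nextPhase (S a) (M + l + 1 + (l + 1)) (pivot (S a) M (M + l + 1) + (i + 1)) = some k →
      ∃ r, r 0 = phasePoint θ (pivot (S a) M (M + l + 1) + (l + 1) * e) ∧
        (periodicBouquet n M l S).Visits (flowerSrc (M + l + 1) l a (M + l + 1 + (i + 1)))
          (phasePoint θ (k + (l + 1) * e)) r := by
  induction i with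
  | zero =>
    intro k _ hk
    obtain ⟨r, hr0, hv⟩ := hstart
    have := (nextPhase_eq_some hk).1
    exact ⟨r, hr0, hv.delay (phasePoint_mono h0 h1 (by omega))⟩
  | succ i ih =>
    intro k hi hk
    obtain ⟨hle, hlt, hSk⟩ := nextPhase_eq_some hk
    obtain ⟨k', hk', hnext⟩ := exists_nextPhase
      (x := pivot (S a) M (M + l + 1) + (i + 1)) (by omega) hlt hSk
    obtain ⟨r, hr0, hv⟩ := ih k' (by omega) hnext
    obtain ⟨hle', -, hSk'⟩ := nextPhase_eq_some hnext
    have hpar := hp.parity k' (by have := hp.le; omega) hSk'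
    refine ⟨_, ?_, ((hv.jump (edge_mem ha (by omega)) rfl
      (guardHolds_loop h0 h1 hv.reset_le hl hr0 hpar hnext)).delay
        (phasePoint_mono h0 h1 (Nat.add_le_add_right hk' _))).congr_loc ?_⟩
    · rw [resetAt_flowerEdge, if_neg (by omega), hr0]
    · exact flowerTgt_of_lt (by omega)

theorem visits_loop_start (h0 : 0 < θ) (h1 : θ < 1) (ha : a < n) (hp : HasPivot (S a) M l)
    (hS : ∀ k, M ≤ k → S a (k + (l + 1)) = S a k) (hl : (l + 1) % 2 = 0) (e : ℕ) :
    ∃ r, r 0 = phasePoint θ (pivot (S a) M (M + l + 1) + (l + 1) * e) ∧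
      (periodicBouquet n M l S).Visits (flowerSrc (M + l + 1) l a (M + l + 1 + 1))
        (phasePoint θ (pivot (S a) M (M + l + 1) + (l + 1) * e)) r := by
  have hlt := hp.lt
  induction e with
  | zero =>
    have hnext : nextPhase (S a) (M + l + 1 + (l + 1))
        (min (M + l + 1) (pivot (S a) M (M + l + 1))) = some (pivot (S a) M (M + l + 1)) := by
      rw [min_eq_right hlt.le]
      exact nextPhase_self (by omega) hp.mem
    obtain ⟨r, hr0, hv⟩ := visits_stalk h0 h1 ha _ _ le_rfl hnext
    refine ⟨_, ?_, (hv.jump (edge_mem ha (by omega)) rfl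
      (guardHolds_stalk h0 h1 le_rfl hv.reset_le hr0 hnext)).congr_loc ?_⟩
    · rw [resetAt_flowerEdge, if_pos (Or.inl rfl)]
      rfl
    · exact flowerTgt_of_lt (by omega)
  | succ e ih =>
    have hnext : nextPhase (S a) (M + l + 1 + (l + 1))
        (pivot (S a) M (M + l + 1) + (l + 1)) = some (pivot (S a) M (M + l + 1) + (l + 1)) :=
      nextPhase_self (by omega) ((hS _ hp.le).trans hp.mem)
    obtain ⟨r, hr0, hv⟩ := visits_loop_of_start h0 h1 ha hp hl ih l _ le_rfl hnext
    have hpar := hp.parity _ (by have := hp.le; omega) ((hS _ hp.le).trans hp.mem)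
    have heq : pivot (S a) M (M + l + 1) + (l + 1) + (l + 1) * e =
        pivot (S a) M (M + l + 1) + (l + 1) * (e + 1) := by ring
    have hv' := hv.jump (edge_mem ha (by omega)) rfl
      (guardHolds_loop h0 h1 hv.reset_le hl hr0 hpar hnext)
    rw [heq] at hv'
    refine ⟨_, ?_, hv'.congr_loc ?_⟩
    · rw [resetAt_flowerEdge, if_pos (Or.inr (by omega))]
    · change flowerTgt _ _ _ _ = _
      have : M + l + 1 + (l + 1) = M + l + 1 + 1 + l := by omega
      rw [this, flowerTgt_last]

end Realization

theorem occurs_of_phase (hS : ∀ a k, M ≤ k → S a (k + (l + 1)) = S a k) (hl : (l + 1) % 2 = 0)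
    {a k : ℕ} (ha : a < n) (hk : S a k = true) {t : ℝ} (ht : InPhase k t) :
    (periodicBouquet n M l S).Occurs a t := by
  obtain ⟨θ, h0, h1, hθ⟩ := ht
  obtain rfl : t = phasePoint θ k := hθ
  have hpiv := pivot_spec (hS a) hl
  by_cases hkp : k ≤ pivot (S a) M (M + l + 1)
  · have hks : k ≤ M + l + 1 := by omega
    have hnext : nextPhase (S a) (M + l + 1 + (l + 1))
        (min k (pivot (S a) M (M + l + 1))) = some k := by
      rw [min_eq_left hkp]
      exact nextPhase_self (by omega) hk
    obtain ⟨r, hr0, hv⟩ := visits_stalk h0 h1 ha _ _ hks hnext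
    exact ⟨r, _, edge_mem ha (by omega), hv,
      guardHolds_stalk h0 h1 hks hv.reset_le hr0 hnext, rfl⟩
  · rcases hpiv with ⟨hp, hnone⟩ | ⟨hMp, hps, hSp, hpar⟩
    · rw [hnone k (by omega)] at hk
      exact absurd hk Bool.false_ne_true
    · have hp : HasPivot (S a) M l := ⟨hMp, hps, hSp, hpar⟩
      set p := pivot (S a) M (M + l + 1) with hpdef
      have hpos : 0 < l + 1 := by omega
      obtain ⟨i, e, hi, rfl⟩ : ∃ i e, i ≤ l ∧ k = p + (i + 1) + (l + 1) * e :=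
        ⟨(k - (p + 1)) % (l + 1), (k - (p + 1)) / (l + 1), Nat.lt_succ_iff.1 (Nat.mod_lt _ hpos),
          by have := Nat.mod_add_div (k - (p + 1)) (l + 1); omega⟩
      have hnext : nextPhase (S a) (M + l + 1 + (l + 1)) (p + (i + 1)) = some (p + (i + 1)) :=
        nextPhase_self (by omega) ((eq_of_periodic (hS a) (by omega) e).symm.trans hk)
      obtain ⟨r, hr0, hv⟩ := visits_loop_of_start h0 h1 ha hp hl
        (visits_loop_start h0 h1 ha hp (hS a) hl e) i _ hi hnext
      have hpar' := hpar (p + (i + 1)) (by omega) (nextPhase_eq_some hnext).2.2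
      exact ⟨r, _, edge_mem ha (show M + l + 1 + (i + 1) ≤ _ by omega), hv,
        guardHolds_loop h0 h1 hv.reset_le hl hr0 hpar' hnext, rfl⟩

end BouquetSemantics

/-! ### The construction -/

/-- The deterministic bouquet with the same timestamp as `A`. -/
def TimedAutomaton.timestampAutomaton (A : TimedAutomaton) : TimedAutomaton :=
  periodicBouquet A.numActs (2 * A.preperiod) (2 * A.period - 1) fun a k => A.observes a k

theorem primrec_timestampAutomaton : Primrec TimedAutomaton.timestampAutomaton := by
  unfold TimedAutomaton.timestampAutomaton periodicBouquet
  fun_prop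

theorem TimedAutomaton.timestamp_timestampAutomaton {A : TimedAutomaton} (hA : A.IsENTA) :
    A.timestampAutomaton.timestamp = A.timestamp := by
  have hpos := A.period_pos
  have hper : 2 * A.period - 1 + 1 = 2 * A.period := by omega
  have hS : ∀ a k, 2 * A.preperiod ≤ k →
      A.observes a (k + (2 * A.period - 1 + 1)) = A.observes a k := fun a k hk => by
    rw [hper, observes_add_period hk]
  have hl : (2 * A.period - 1 + 1) % 2 = 0 := by omega
  ext ⟨t, a⟩
  rw [mem_timestamp_iff, mem_timestamp_iff]
  constructor
  · intro h
    obtain ⟨-, k, hk, hph⟩ := exists_phase_of_occurs hS hl h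
    exact (occurs_iff_observes hA hph).2 hk
  · intro h
    have ha : a < A.numActs := by
      obtain ⟨r, τ, hτ, -, -, hact⟩ := h
      exact hA.act_lt τ hτ a hact
    obtain ⟨k, hph⟩ := exists_inPhase h.nonneg
    exact occurs_of_phase hS hl ha ((occurs_iff_observes hA hph).1 h) hph

theorem mainTheorem4 :
    ∃ TSA : TimedAutomaton → TimedAutomaton, Computable TSA ∧
      ∀ A : TimedAutomaton, A.IsENTA →
        (TSA A).IsENTA ∧
        (TSA A).numActs = A.numActs ∧
        (TSA A).numClocks = 1 ∧
        (TSA A).IsDeterministic ∧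
        (TSA A).IsBouquet ∧
        (TSA A).timestamp = A.timestamp :=
  ⟨TimedAutomaton.timestampAutomaton, primrec_timestampAutomaton.to_comp, fun A hA =>
    ⟨bouquet_isENTA fun _ _ => clock_of_mem_optionalGuard, rfl, rfl, bouquet_isDeterministic,
      bouquet_isBouquet, A.timestamp_timestampAutomaton hA⟩⟩
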